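/- Let $p$ be an odd prime, $q$ a power of $p$, and $\omega:\mathbb F_q\to\mathbb C$, $\omega(\lambda)=e^{2\pi i\,\mathrm{Tr}(\lambda)/p}$, where $\mathrm{Tr}$ is the trace to $\mathbb F_p$. For finite-dimensional $\mathbb F_q$-vector spaces $P,Q$ in perfect duality $\langle\cdot,\cdot\rangle$, equip $P\oplus Q$ with the symplectic form $[x\oplus y,x'\oplus y']=\langle x,y'\rangle-\langle x',y\rangle$. The oscillator representation $\mu$ of $\mathrm{Sp}(P\oplus Q)$ on the space $L^2(Q)$ of functions $Q\to\mathbb C$ is the representation determined by $$\mu\begin{pmatrix}1&A\\0&1\end{pmatrix}\delta_y=\omega\big(2^{-1}\langle Ay,y\rangle\big)\delta_y,\qquad \mu\begin{pmatrix}0&B\\-B^{-1}&0\end{pmatrix}\delta_y=\gamma(B)^{-1}\sum_{y'\in Q}\omega\big(\langle By,y'\rangle\big)\delta_{y'},\qquad \mu\begin{pmatrix}C&0\\0&C^{-t}\end{pmatrix}\delta_y=\Big(\frac{\det C}{q}\Big)\delta_{C^{-t}y},$$ for $A,B:Q\to P$ symmetric, $B$ invertible, $C\in GL(P)$, where $\gamma(B)=\sum_{y\in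 Q}\omega(-2^{-1}\langle By,y\rangle)$. Let $X$ be a finite-dimensional $\mathbb F_q$-vector space and $V=X\oplus X^*$. For a finite-dimensional $\mathbb F_q$-vector space $U$ with non-degenerate symmetric bilinear form $\beta$, identify $U\otimes V=(U\otimes X)\oplus\mathrm{Hom}(X\to U)$ with the pairing $\langle u\otimes x,F\rangle=\beta(u,Fx)$. Restricting the oscillator representation of $\mathrm{Sp}(U\otimes V)$ along $(g,S)\mapsto g\otimes S$ gives a representation $\mu_{U\otimes V}$ of $O(U)\times\mathrm{Sp}(V)$ on $L^2(\mathrm{Hom}(X\to U))$. The discriminant $d(U)\in\mathbb F_q^\times/(\mathbb F_q^\times)^2$ is the square class of the determinant of a Gram matrix of $\beta$. Let $N\subset U$ be an isotropic subspace, i.e. $N\subset N^\perp$, let $O_N\subset O(U)$ be its (setwise) stabilizer, and let $$C_N=\{\Phi\in L^2(\mathrm{Hom}(X\to U)) : \operatorname{supp}\Phi\subset\mathrm{Hom}(X\to N^\perp),\ \Phi(F)=\Phi(F')\text{ whenever }F-F'\in\mathrm{Hom}(X\to N)\}.$$ **Lemma.** 1. The form $\beta'([u],[v])=\beta(u,v)$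 on $U'=N^\perp/N$ is well defined, symmetric and non-degenerate, and $\dim U'=\dim U-2\dim N$, $d(U')=(-1)^{\dim N}d(U)$. 2. The group $O_N$ acts on $U'$ by $g[u]=[gu]$, and the maps that arise this way are exactly the elements of $O(U')$; i.e. this defines a surjective homomorphism $i:O_N\to O(U')$. 3. The subspace $C_N$ is invariant under the restriction of $\mu_{U\otimes V}$ to $O_N\times\mathrm{Sp}(V)$. The resulting representation of $O_N\times\mathrm{Sp}(V)$ on $C_N$ is equivalent to $\mu_{U'\otimes V}\circ(i\times\mathrm{id})$; that is, it factors through $O(U')\times\mathrm{Sp}(V)$, and as a representation of that group it is equivalent to $\mu_{U'\otimes V}$. -/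

import Mathlib

namespace CSSRep

section Forms

variable {F : Type*} [Field F]

/-- The group of all linear automorphisms that preserve a bilinear form. -/
def isometryGroup {M : Type*} [AddCommGroup M] [Module F M] (ω : M →ₗ[F] M →ₗ[F] F) :
    Subgroup (M ≃ₗ[F] M) where
  carrier := {g | ∀ v w, ω (g v) (g w) = ω v w}
  mul_mem' := by
    intro a b ha hb v w
    exact (ha (b v) (b w)).trans (hb v w)
  one_mem' := by intro v w; rfl
  inv_mem' := by
    intro a ha v w
    have h := ha (a⁻¹ v) (a⁻¹ w)
    have e : ∀ u, a (a⁻¹ u) = u := fun u => a.apply_symm_apply u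
    rw [e, e] at h
    exact h.symm

variable {P Q : Type*} [AddCommGroup P] [Module F P] [AddCommGroup Q] [Module F Q]

/-- The symplectic form `[x ⊕ y, x' ⊕ y'] = ⟨x, y'⟩ - ⟨x', y⟩` on `P ⊕ Q`, for a pairing
`⟨·, ·⟩ : P × Q → F`. -/
def symplecticForm (b : P →ₗ[F] Q →ₗ[F] F) : (P × Q) →ₗ[F] (P × Q) →ₗ[F] F :=
  LinearMap.mk₂ F (fun v w => b v.1 w.2 - b w.1 v.2)
    (by intros; simp; ring) (by intros; simp; ring) (by intros; simp; ring)
    (by intros; simp; ring)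

/-- The symplectic group of `P ⊕ Q`. -/
abbrev Sp (b : P →ₗ[F] Q →ₗ[F] F) : Subgroup ((P × Q) ≃ₗ[F] (P × Q)) :=
  isometryGroup (symplecticForm b)

/-- The Weyl operator `W(x ⊕ y) δ_z = ψ(⟨x, z⟩ + 2⁻¹⟨x, y⟩) δ_{z + y}` on functions on `Q`. -/
def weyl (ψ : AddChar F ℂ) (b : P →ₗ[F] Q →ₗ[F] F) (v : P × Q) : Module.End ℂ (Q → ℂ) where
  toFun f q := ψ (b v.1 q - 2⁻¹ * b v.1 v.2) * f (q - v.2)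
  map_add' f g := by ext q; simp [mul_add]
  map_smul' c f := by ext q; simp; ring

open Classical in
/-- The Legendre symbol of (a nonzero) `a`, as a complex number. -/
noncomputable def legendre (a : F) : ℂ := if IsSquare a then 1 else -1

/-- The Gauss sum `γ(B) = ∑_y ψ(-2⁻¹ ⟨B y, y⟩)`. -/
noncomputable def gauss (ψ : AddChar F ℂ) (b : P →ₗ[F] Q →ₗ[F] F) (B : Q ≃ₗ[F] P) : ℂ :=
  ∑ᶠ y : Q, ψ (-(2⁻¹ * b (B y) y))

/-- The properties that single out the oscillator representation of `Sp(P ⊕ Q)` on `L²(Q)`: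
compatibility with the Weyl operators, and the action of
`N_A = (1, A; 0, 1)`, `J_B = (0, B; -B⁻¹, 0)` and `D_C = (C, 0; 0, C^{-t})`. These elements generate
the symplectic group, so that there is at most one such representation. -/
structure IsOscillator (ψ : AddChar F ℂ) (b : P →ₗ[F] Q →ₗ[F] F)
    (μ : Representation ℂ (Sp b) (Q → ℂ)) : Prop where
  map_weyl : ∀ (S : Sp b) (v : P × Q),
    μ S * weyl ψ b v = weyl ψ b ((S : (P × Q) ≃ₗ[F] (P × Q)) v) * μ S
  map_N : ∀ (S : Sp b) (A : Q →ₗ[F] P),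
    (∀ x y, (S : (P × Q) ≃ₗ[F] (P × Q)) (x, y) = (x + A y, y)) →
      ∀ f y, μ S f y = ψ (2⁻¹ * b (A y) y) * f y
  map_J : ∀ (S : Sp b) (B : Q ≃ₗ[F] P),
    (∀ x y, (S : (P × Q) ≃ₗ[F] (P × Q)) (x, y) = (B y, -B.symm x)) →
      ∀ f y', μ S f y' = (gauss ψ b B)⁻¹ * ∑ᶠ y : Q, ψ (b (B y) y') * f y
  map_D : ∀ (S : Sp b) (C : P ≃ₗ[F] P) (D : Q ≃ₗ[F] Q),
    (∀ x y, (S : (P × Q) ≃ₗ[F] (P × Q)) (x, y) = (C x, D y)) →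
      ∀ f y, μ S f (D y) = legendre (LinearMap.det (C : P →ₗ[F] P)) * f y

end Forms

section Parity

variable {F : Type*} [Field F] {Q : Type*} [AddCommGroup Q] [Module F Q]

/-- The parity operator `f ↦ f(-·)`. -/
def parity (Q : Type*) [AddCommGroup Q] : Module.End ℂ (Q → ℂ) where
  toFun f q := f (-q)
  map_add' _ _ := rfl
  map_smul' _ _ := rfl

/-- Projection onto even functions. -/
noncomputable def evenProj (Q : Type*) [AddCommGroup Q] : Module.End ℂ (Q → ℂ) :=
  (2⁻¹ : ℂ) • (1 + parity Q)

/-- Projection onto odd functions. -/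
noncomputable def oddProj (Q : Type*) [AddCommGroup Q] : Module.End ℂ (Q → ℂ) :=
  (2⁻¹ : ℂ) • (1 - parity Q)

/-- Determinant on even functions of an operator commuting with the parity. -/
noncomputable def evenDet (T : Module.End ℂ (Q → ℂ)) : ℂ :=
  LinearMap.det (T * evenProj Q + oddProj Q)

/-- Determinant on odd functions of an operator commuting with the parity. -/
noncomputable def oddDet (T : Module.End ℂ (Q → ℂ)) : ℂ :=
  LinearMap.det (T * oddProj Q + evenProj Q)

lemma parity_sq : parity Q * parity Q = 1 := by
  ext f q; simp [parity]

lemma evenProj_mul_self : evenProj Q * evenProj Q = evenProj Q := by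
  have := parity_sq (Q := Q)
  simp only [evenProj, smul_mul_smul_comm, add_mul, mul_add, one_mul, mul_one, this]
  module

lemma oddProj_mul_self : oddProj Q * oddProj Q = oddProj Q := by
  have := parity_sq (Q := Q)
  simp only [oddProj, smul_mul_smul_comm, sub_mul, mul_sub, one_mul, mul_one, this]
  module

lemma even_mul_odd : evenProj Q * oddProj Q = 0 := by
  have := parity_sq (Q := Q)
  simp only [evenProj, oddProj, smul_mul_smul_comm, add_mul, mul_sub, one_mul, mul_one, this]
  module

lemma odd_mul_even : oddProj Q * evenProj Q = 0 := by
  have := parity_sq (Q := Q)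
  simp only [evenProj, oddProj, smul_mul_smul_comm, sub_mul, mul_add, one_mul, mul_one, this]
  module

lemma even_add_odd : evenProj Q + oddProj Q = 1 := by
  simp only [evenProj, oddProj]; module

lemma comm_even {T : Module.End ℂ (Q → ℂ)} (h : Commute T (parity Q)) :
    Commute T (evenProj Q) := ((Commute.one_right T).add_right h).smul_right _

lemma comm_odd {T : Module.End ℂ (Q → ℂ)} (h : Commute T (parity Q)) :
    Commute T (oddProj Q) := ((Commute.one_right T).sub_right h).smul_right _

lemma evenDet_mul (T : Module.End ℂ (Q → ℂ)) {T' : Module.End ℂ (Q → ℂ)}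
    (h : Commute T' (parity Q)) : evenDet (T * T') = evenDet T * evenDet T' := by
  rw [evenDet, evenDet, evenDet, ← map_mul]
  congr 1
  have e := (comm_even h).eq
  have o := (comm_odd h).eq
  have h1 : T * evenProj Q * (T' * evenProj Q) = T * T' * evenProj Q := by
    rw [mul_assoc, ← mul_assoc (evenProj Q), ← e, mul_assoc T', evenProj_mul_self, mul_assoc]
  have h2 : oddProj Q * (T' * evenProj Q) = 0 := by
    rw [← mul_assoc, ← o, mul_assoc, odd_mul_even, mul_zero]
  rw [add_mul, mul_add, mul_add, h1, h2, mul_assoc T (evenProj Q), even_mul_odd, oddProj_mul_self]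
  simp

lemma oddDet_mul (T : Module.End ℂ (Q → ℂ)) {T' : Module.End ℂ (Q → ℂ)}
    (h : Commute T' (parity Q)) : oddDet (T * T') = oddDet T * oddDet T' := by
  rw [oddDet, oddDet, oddDet, ← map_mul]
  congr 1
  have e := (comm_even h).eq
  have o := (comm_odd h).eq
  have h1 : T * oddProj Q * (T' * oddProj Q) = T * T' * oddProj Q := by
    rw [mul_assoc, ← mul_assoc (oddProj Q), ← o, mul_assoc T', oddProj_mul_self, mul_assoc]
  have h2 : evenProj Q * (T' * oddProj Q) = 0 := by
    rw [← mul_assoc, ← e, mul_assoc, even_mul_odd, mul_zero]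
  rw [add_mul, mul_add, mul_add, h1, h2, mul_assoc T (oddProj Q), odd_mul_even, evenProj_mul_self]
  simp

lemma evenDet_one : evenDet (1 : Module.End ℂ (Q → ℂ)) = 1 := by
  rw [evenDet, one_mul, even_add_odd, map_one]

lemma oddDet_one : oddDet (1 : Module.End ℂ (Q → ℂ)) = 1 := by
  rw [oddDet, one_mul, add_comm, even_add_odd, map_one]

/-- Multiplication by a function. -/
def mulOp (m : Q → ℂ) : Module.End ℂ (Q → ℂ) where
  toFun f q := m q * f q
  map_add' f g := by ext q; simp [mul_add]
  map_smul' c f := by ext q; simp; ring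

lemma det_mulOp [Fintype Q] (m : Q → ℂ) : LinearMap.det (mulOp m) = ∏ q, m q := by
  classical
  have : mulOp m = Matrix.toLin' (Matrix.diagonal m) := by
    ext f q; simp [mulOp, Matrix.toLin'_apply, Matrix.mulVec_diagonal]
  rw [this, LinearMap.det_toLin', Matrix.det_diagonal]

lemma mulOp_comm_parity {m : Q → ℂ} (hm : ∀ q, m (-q) = m q) : Commute (mulOp m) (parity Q) := by
  ext f q; simp [mulOp, parity, hm]

lemma self_eq_neg_iff' (h2 : (2 : F) ≠ 0) (q : Q) : q = -q ↔ q = 0 := by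
  constructor
  · intro h
    have : (2 : F) • q = 0 := by rw [two_smul]; nth_rewrite 2 [h]; simp
    exact (smul_eq_zero.mp this).resolve_left h2
  · rintro rfl; simp

lemma exists_sign [Finite Q] (h2 : (2 : F) ≠ 0) :
    ∃ s : Q → ℂ, (∀ q, s q ≠ 0) ∧ ∀ q, q ≠ 0 → s (-q) = - s q := by
  obtain ⟨n, ⟨e⟩⟩ := Finite.exists_equiv_fin Q
  refine ⟨fun q => if e q < e (-q) then 1 else -1, fun q => by dsimp only; split_ifs <;> simp, fun q hq => ?_⟩
  have hne : e q ≠ e (-q) := fun h => hq ((self_eq_neg_iff' h2 q).mp (e.injective h))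
  rcases lt_or_gt_of_ne hne with h | h
  · simp [h, h.not_gt]
  · simp [h, h.not_gt]

lemma evenDet_mulOp [Finite Q] (h2 : (2 : F) ≠ 0) (m : Q → ℂ) :
    evenDet (mulOp m) = m 0 * oddDet (mulOp m) := by
  classical
  have := Fintype.ofFinite Q
  obtain ⟨s, hs0, hs⟩ := exists_sign (Q := Q) h2
  have key : mulOp s * (mulOp m * evenProj Q + oddProj Q)
      = (mulOp m * oddProj Q + evenProj Q) * mulOp (fun q => if q = 0 then m 0 else 1) *
        mulOp s := by
    refine LinearMap.ext fun f => funext fun q => ?_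
    simp only [mulOp, evenProj, oddProj, parity, Module.End.mul_apply, LinearMap.add_apply,
      LinearMap.smul_apply, LinearMap.sub_apply, Module.End.one_apply, LinearMap.coe_mk,
      AddHom.coe_mk, Pi.add_apply, Pi.smul_apply, Pi.sub_apply, smul_eq_mul, neg_eq_zero]
    by_cases hq : q = 0
    · subst hq; simp; ring
    · rw [hs q hq]; simp [hq]; ring
  have hd := congrArg LinearMap.det key
  rw [map_mul, map_mul, map_mul, det_mulOp (fun q => if q = 0 then m 0 else 1)] at hd
  have hs' : LinearMap.det (mulOp s) ≠ 0 := by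
    rw [det_mulOp]; exact Finset.prod_ne_zero_iff.mpr fun q _ => hs0 q
  have hp : (∏ q : Q, if q = 0 then m 0 else 1) = m 0 := by simp
  rw [hp] at hd
  have : evenDet (mulOp m) = m 0 * oddDet (mulOp m) := by
    apply mul_left_cancel₀ hs'
    rw [evenDet, oddDet, hd]; ring
  exact this

lemma smul_one_eq_mulOp (c : ℂ) : (c • 1 : Module.End ℂ (Q → ℂ)) = mulOp fun _ => c := by
  ext f q; simp [mulOp]

lemma evenDet_smul_one [Finite Q] (h2 : (2 : F) ≠ 0) (c : ℂ) :
    evenDet (c • 1 : Module.End ℂ (Q → ℂ)) = c * oddDet (c • 1 : Module.End ℂ (Q → ℂ)) := by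
  rw [smul_one_eq_mulOp]; exact evenDet_mulOp h2 _

lemma oddDet_smul_one_ne [Finite Q] {c : ℂ} (hc : c ≠ 0) :
    oddDet (c • 1 : Module.End ℂ (Q → ℂ)) ≠ 0 := by
  have h := oddDet_mul (c • 1 : Module.End ℂ (Q → ℂ)) (T' := c⁻¹ • 1)
    ((Commute.one_left _).smul_left _)
  rw [smul_mul_smul_comm, mul_inv_cancel₀ hc, one_smul, one_mul, oddDet_one] at h
  exact left_ne_zero_of_mul (h ▸ one_ne_zero)

/-- An operator that commutes with the parity, is invertible and has equal even and odd
determinants. -/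
structure Normalized (T : Module.End ℂ (Q → ℂ)) : Prop where
  comm : Commute T (parity Q)
  unit : IsUnit T
  det_eq : evenDet T = oddDet T

lemma comm_inv {T T' : Module.End ℂ (Q → ℂ)} (h : Commute T (parity Q)) (h1 : T * T' = 1)
    (h2 : T' * T = 1) : Commute T' (parity Q) := by
  have : T' * (T * parity Q) * T' = T' * (parity Q * T) * T' := by rw [h.eq]
  simp only [← mul_assoc] at this
  rw [h2, one_mul, mul_assoc, h1, mul_one] at this
  exact this.symm

lemma oddDet_ne_zero {T : Module.End ℂ (Q → ℂ)} (h : Commute T (parity Q)) (hu : IsUnit T) :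
    oddDet T ≠ 0 := by
  obtain ⟨u, rfl⟩ := hu
  have := oddDet_mul (u : Module.End ℂ (Q → ℂ)) (comm_inv h u.mul_inv u.inv_mul)
  rw [u.mul_inv, oddDet_one] at this
  exact left_ne_zero_of_mul (this ▸ one_ne_zero)

lemma evenDet_ne_zero {T : Module.End ℂ (Q → ℂ)} (h : Commute T (parity Q)) (hu : IsUnit T) :
    evenDet T ≠ 0 := by
  obtain ⟨u, rfl⟩ := hu
  have := evenDet_mul (u : Module.End ℂ (Q → ℂ)) (comm_inv h u.mul_inv u.inv_mul)
  rw [u.mul_inv, evenDet_one] at this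
  exact left_ne_zero_of_mul (this ▸ one_ne_zero)

lemma Normalized.mul {T T' : Module.End ℂ (Q → ℂ)} (h : Normalized T) (h' : Normalized T') :
    Normalized (T * T') :=
  ⟨h.comm.mul_left h'.comm, h.unit.mul h'.unit, by
    rw [evenDet_mul _ h'.comm, oddDet_mul _ h'.comm, h.det_eq, h'.det_eq]⟩

lemma Normalized.one : Normalized (1 : Module.End ℂ (Q → ℂ)) :=
  ⟨Commute.one_left _, isUnit_one, by rw [evenDet_one, oddDet_one]⟩

lemma det_smul_aux [Finite Q] (h2 : (2 : F) ≠ 0) {T : Module.End ℂ (Q → ℂ)}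
    (hT : Commute T (parity Q)) (c : ℂ) :
    evenDet (c • T) = c * oddDet (c • 1 : Module.End ℂ (Q → ℂ)) * evenDet T ∧
    oddDet (c • T) = oddDet (c • 1 : Module.End ℂ (Q → ℂ)) * oddDet T := by
  have : c • T = (c • 1) * T := by simp
  rw [this, evenDet_mul _ hT, oddDet_mul _ hT, evenDet_smul_one h2]
  exact ⟨rfl, rfl⟩

/-- The normalizing scalar of an operator. -/
noncomputable def detRatio (T : Module.End ℂ (Q → ℂ)) : ℂ := oddDet T / evenDet T

lemma Normalized.smul_iff [Finite Q] (h2 : (2 : F) ≠ 0) {T : Module.End ℂ (Q → ℂ)}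
    (hT : Commute T (parity Q)) (hu : IsUnit T) {c : ℂ} (hc : c ≠ 0) :
    Normalized (c • T) ↔ c = detRatio T := by
  obtain ⟨he, ho⟩ := det_smul_aux h2 hT c
  have h1 := oddDet_smul_one_ne (Q := Q) hc
  have h3 := evenDet_ne_zero hT hu
  constructor
  · intro h
    have h4 := h.det_eq
    rw [he, ho] at h4
    rw [detRatio, eq_div_iff h3]
    apply mul_left_cancel₀ h1
    linear_combination h4
  · intro h
    refine ⟨hT.smul_left c, hu.smul (Units.mk0 c hc), ?_⟩
    rw [he, ho]
    rw [detRatio, eq_div_iff h3] at h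
    linear_combination (oddDet (c • 1 : Module.End ℂ (Q → ℂ))) * h

lemma detRatio_ne_zero {T : Module.End ℂ (Q → ℂ)}
    (hT : Commute T (parity Q)) (hu : IsUnit T) : detRatio T ≠ 0 :=
  div_ne_zero (oddDet_ne_zero hT hu) (evenDet_ne_zero hT hu)

lemma Normalized.eq_of_smul [Finite Q] (h2 : (2 : F) ≠ 0) {T T' : Module.End ℂ (Q → ℂ)}
    (hT : Normalized T) (hT' : Normalized T') {c : ℂ} (hc : T' = c • T) : T' = T := by
  have hT2 : Normalized ((1 : ℂ) • T) := by rwa [one_smul]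
  have e1 := (Normalized.smul_iff h2 hT.comm hT.unit one_ne_zero).mp hT2
  by_cases h0 : c = 0
  · subst h0
    rw [zero_smul] at hc
    subst hc
    have hu := hT'.unit
    have := isUnit_zero_iff.mp hu
    calc (0 : Module.End ℂ (Q → ℂ)) = 0 * T := by simp
      _ = T := by rw [this, one_mul]
  · rw [hc] at hT'
    have e2 := (Normalized.smul_iff h2 hT.comm hT.unit h0).mp hT'
    rw [hc, e2, ← e1, one_smul]

lemma detRatio_mul (T : Module.End ℂ (Q → ℂ)) {T' : Module.End ℂ (Q → ℂ)}
    (hT' : Commute T' (parity Q)) : detRatio (T * T') = detRatio T * detRatio T' := by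
  rw [detRatio, detRatio, detRatio, evenDet_mul _ hT', oddDet_mul _ hT']
  rw [mul_div_mul_comm]

lemma Normalized.conj {T u v : Module.End ℂ (Q → ℂ)} (hT : Normalized T)
    (hu : Commute u (parity Q)) (h1 : u * v = 1) (h2 : v * u = 1) : Normalized (u * T * v) := by
  have hv := comm_inv hu h1 h2
  refine ⟨(hu.mul_left hT.comm).mul_left hv, ?_, ?_⟩
  · have hu' : IsUnit u := ⟨⟨u, v, h1, h2⟩, rfl⟩
    have hv' : IsUnit v := ⟨⟨v, u, h2, h1⟩, rfl⟩
    exact (hu'.mul hT.unit).mul hv'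
  · have a := evenDet_mul u hv
    have b := oddDet_mul u hv
    rw [h1, evenDet_one] at a
    rw [h1, oddDet_one] at b
    rw [evenDet_mul _ hv, evenDet_mul _ hT.comm, oddDet_mul _ hv, oddDet_mul _ hT.comm, hT.det_eq]
    linear_combination (oddDet T) * (b - a)

end Parity

end CSSRep

namespace CSSRep

section Weyl

variable {F : Type*} [Field F] {P Q : Type*} [AddCommGroup P] [Module F P]
  [AddCommGroup Q] [Module F Q]

lemma sum_char_bilin [Finite F] {M N : Type*} [AddCommGroup M] [Module F M] [AddCommGroup N]
    [Module F N] [Fintype M] {ψ : AddChar F ℂ} (hψ : ψ ≠ 1) (c : M →ₗ[F] N →ₗ[F] F)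
    (hc : Function.Injective c.flip) (n : N) [Decidable (n = 0)] :
    ∑ m : M, ψ (c m n) = if n = 0 then (Fintype.card M : ℂ) else 0 := by
  classical
  have h := AddChar.sum_eq_ite (ψ.compAddMonoidHom (c.flip n).toAddMonoidHom)
  simp only [AddChar.compAddMonoidHom_apply, LinearMap.toAddMonoidHom_coe,
    LinearMap.flip_apply] at h
  rw [h]
  by_cases hn : n = 0
  · subst hn
    have h1 : ψ.compAddMonoidHom (c.flip 0).toAddMonoidHom = 0 := by
      ext m; simp
    rw [if_pos h1, if_pos rfl]
  · rw [if_neg hn, if_neg]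
    intro h0
    apply hψ
    have hne : c.flip n ≠ 0 := fun h => hn (hc (by rw [h, map_zero]))
    obtain ⟨m, hm⟩ : ∃ m, c.flip n m ≠ 0 := by
      by_contra hcon
      push Not at hcon
      exact hne (LinearMap.ext hcon)
    ext a
    have h3 := DFunLike.congr_fun h0 ((a / c.flip n m) • m)
    simp only [AddChar.compAddMonoidHom_apply, LinearMap.toAddMonoidHom_coe, map_smul,
      smul_eq_mul, div_mul_cancel₀ _ hm] at h3
    rw [h3]; rfl

variable (ψ : AddChar F ℂ) (b : P →ₗ[F] Q →ₗ[F] F)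

lemma weyl_apply (v : P × Q) (f : Q → ℂ) (q : Q) :
    weyl ψ b v f q = ψ (b v.1 q - 2⁻¹ * b v.1 v.2) * f (q - v.2) := rfl

lemma symplecticForm_apply (v w : P × Q) :
    symplecticForm b v w = b v.1 w.2 - b w.1 v.2 := rfl

lemma weyl_mul (h2 : (2 : F) ≠ 0) (v w : P × Q) :
    weyl ψ b v * weyl ψ b w = ψ (2⁻¹ * symplecticForm b v w) • weyl ψ b (v + w) := by
  refine LinearMap.ext fun f => funext fun q => ?_
  simp only [Module.End.mul_apply, weyl_apply, LinearMap.smul_apply, Pi.smul_apply, smul_eq_mul,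
    symplecticForm_apply, ← mul_assoc, ← AddChar.map_add_eq_mul]
  congr 2
  · simp only [Prod.fst_add, Prod.snd_add, map_add, map_sub, LinearMap.add_apply]
    field_simp
    ring
  · simp only [Prod.snd_add]; abel

lemma weyl_zero : weyl ψ b 0 = 1 := by
  ext f q; simp [weyl_apply]

lemma symplecticForm_self (v : P × Q) : symplecticForm b v v = 0 := by
  simp [symplecticForm_apply]

lemma symplecticForm_swap (v w : P × Q) : symplecticForm b v w = - symplecticForm b w v := by
  simp [symplecticForm_apply]

lemma weyl_mul_neg (h2 : (2 : F) ≠ 0) (v : P × Q) : weyl ψ b v * weyl ψ b (-v) = 1 := by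
  rw [weyl_mul ψ b h2, map_neg, symplecticForm_self]; simp [weyl_zero]

lemma weyl_conj (h2 : (2 : F) ≠ 0) (u w : P × Q) :
    weyl ψ b u * weyl ψ b w * weyl ψ b (-u) = ψ (symplecticForm b u w) • weyl ψ b w := by
  rw [weyl_mul ψ b h2, smul_mul_assoc, weyl_mul ψ b h2, smul_smul, ← AddChar.map_add_eq_mul]
  congr 2
  · simp only [map_neg, map_add, LinearMap.add_apply, symplecticForm_self,
      symplecticForm_swap b w u]
    field_simp; ring
  · abel

lemma symplecticForm_injective [hb : b.IsPerfPair] :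
    Function.Injective (symplecticForm b).flip := by
  rw [injective_iff_map_eq_zero]
  intro w hw
  have h : ∀ v, symplecticForm b v w = 0 := fun v => LinearMap.congr_fun hw v
  have h1 : w.2 = 0 := by
    apply hb.bijective_right.injective
    rw [map_zero]
    ext x
    simpa [symplecticForm_apply] using h (x, 0)
  have h3 : w.1 = 0 := by
    apply hb.bijective_left.injective
    rw [map_zero]
    ext y
    simpa [symplecticForm_apply] using h (0, y)
  exact Prod.ext h3 h1

variable {ψ} {b}

lemma weyl_indep [Finite F] [Fintype P] [Fintype Q] [b.IsPerfPair] (hψ : ψ ≠ 1)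
    (h2 : (2 : F) ≠ 0)
    (d : P × Q → ℂ) (hd : ∑ w, d w • weyl ψ b w = 0) (w₀ : P × Q) : d w₀ = 0 := by
  classical
  have key : ∑ u : P × Q, ψ (symplecticForm b u (-w₀)) •
      (weyl ψ b u * (∑ w, d w • weyl ψ b w) * weyl ψ b (-u)) =
      ((Fintype.card (P × Q) : ℂ) * d w₀) • weyl ψ b w₀ := by
    simp only [Finset.mul_sum, Finset.sum_mul, Finset.smul_sum, mul_smul_comm, smul_mul_assoc,
      weyl_conj ψ b h2]
    rw [Finset.sum_comm]
    have : ∀ w : P × Q, ∑ u : P × Q, ψ (symplecticForm b u (-w₀)) •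
        d w • ψ (symplecticForm b u w) • weyl ψ b w =
        if w = w₀ then ((Fintype.card (P × Q) : ℂ) * d w) • weyl ψ b w else 0 := by
      intro w
      have h := sum_char_bilin hψ (symplecticForm b) (symplecticForm_injective b) (w - w₀)
      have : ∀ u : P × Q, ψ (symplecticForm b u (-w₀)) •
        d w • ψ (symplecticForm b u w) • weyl ψ b w =
          ψ (symplecticForm b u (w - w₀)) • d w • weyl ψ b w := by
        intro u
        rw [sub_eq_add_neg, map_add, AddChar.map_add_eq_mul, mul_comm, mul_smul,
          smul_comm (d w), smul_comm (ψ _) (ψ _), smul_comm]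
      simp only [this]
      rw [← Finset.sum_smul, h]
      simp only [sub_eq_zero]
      split_ifs
      · rw [smul_smul]
      · simp
    simp only [this]
    simp
  rw [hd] at key
  simp only [mul_zero, zero_mul, smul_zero, Finset.sum_const_zero] at key
  have h3 := congrArg (· * weyl ψ b (-w₀)) key
  simp only [zero_mul, smul_mul_assoc, weyl_mul_neg ψ b h2] at h3
  have h4 := congrFun (LinearMap.congr_fun h3 (fun _ => 1)) 0
  have h5 : (Fintype.card (P × Q) : ℂ) ≠ 0 := by
    exact_mod_cast Fintype.card_ne_zero
  simp only [LinearMap.zero_apply, Pi.zero_apply, LinearMap.smul_apply, Module.End.one_apply,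
    Pi.smul_apply, smul_eq_mul, mul_one] at h4
  exact (mul_eq_zero.mp h4.symm).resolve_left h5

lemma weyl_irreducible [Finite F] [Fintype P] [Fintype Q] [hb : b.IsPerfPair] (hψ : ψ ≠ 1)
    (K : Submodule ℂ (Q → ℂ)) (hK : ∀ v, ∀ f ∈ K, weyl ψ b v f ∈ K) (hne : K ≠ ⊥) : K = ⊤ := by
  classical
  obtain ⟨f, hf, hf0⟩ := Submodule.exists_mem_ne_zero_of_ne_bot hne
  obtain ⟨a, ha⟩ := Function.ne_iff.mp hf0
  have h1 : ∑ x : P, ψ (b x (-a)) • weyl ψ b (x, 0) f =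
      ((Fintype.card P : ℂ) * f a) • Pi.single a 1 := by
    ext q
    have h := sum_char_bilin hψ b hb.bijective_right.injective (q - a)
    simp only [Finset.sum_apply, Pi.smul_apply, weyl_apply, smul_eq_mul, ← mul_assoc,
      ← AddChar.map_add_eq_mul]
    have : ∀ x : P, b x (-a) + (b x q - 2⁻¹ * b x 0) = b x (q - a) := by
      intro x; simp [sub_eq_add_neg, add_comm]
    simp only [this, sub_zero]
    rw [← Finset.sum_mul, h]
    by_cases hq : q = a
    · subst hq; simp
    · simp [sub_eq_zero, hq]
  have h2 : (Pi.single a 1 : Q → ℂ) ∈ K := by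
    have h3 : ((Fintype.card P : ℂ) * f a) • (Pi.single a 1 : Q → ℂ) ∈ K := by
      rw [← h1]
      exact Submodule.sum_mem _ fun x _ => K.smul_mem _ (hK _ _ hf)
    have h4 : ((Fintype.card P : ℂ) * f a) ≠ 0 :=
      mul_ne_zero (by exact_mod_cast Fintype.card_ne_zero) ha
    exact (K.smul_mem_iff h4).mp h3
  have h3 : ∀ q, (Pi.single q 1 : Q → ℂ) ∈ K := by
    intro q
    have : weyl ψ b (0, q - a) (Pi.single a 1) = Pi.single q 1 := by
      ext r
      simp [weyl_apply, Pi.single_apply, sub_eq_iff_eq_add]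
    rw [← this]
    exact hK _ _ h2
  rw [eq_top_iff]
  intro g _
  rw [← Finset.univ_sum_single g]
  refine Submodule.sum_mem _ fun q _ => ?_
  have : (Pi.single q (g q) : Q → ℂ) = g q • Pi.single q 1 := by
    rw [← Pi.single_smul]; simp
  rw [this]
  exact K.smul_mem _ (h3 q)

variable (ψ b) in
/-- `T` implements the linear automorphism `S` of `P ⊕ Q` on the Weyl operators. -/
def Implements (S : (P × Q) ≃ₗ[F] (P × Q)) (T : Module.End ℂ (Q → ℂ)) : Prop :=
  ∀ v, T * weyl ψ b v = weyl ψ b (S v) * T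

lemma Implements.mul {S S' : (P × Q) ≃ₗ[F] (P × Q)} {T T' : Module.End ℂ (Q → ℂ)}
    (h : Implements ψ b S T) (h' : Implements ψ b S' T') : Implements ψ b (S * S') (T * T') := by
  intro v
  rw [mul_assoc, h' v, ← mul_assoc, h, mul_assoc]; rfl

lemma Implements.smul {S : (P × Q) ≃ₗ[F] (P × Q)} {T : Module.End ℂ (Q → ℂ)}
    (h : Implements ψ b S T) (c : ℂ) : Implements ψ b S (c • T) := by
  intro v
  rw [smul_mul_assoc, h v, mul_smul_comm]

lemma Implements.isUnit [Finite F] [Fintype P] [Fintype Q] [b.IsPerfPair] (hψ : ψ ≠ 1)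
    {S : (P × Q) ≃ₗ[F] (P × Q)} {T : Module.End ℂ (Q → ℂ)} (h : Implements ψ b S T)
    (h0 : T ≠ 0) : IsUnit T := by
  have hk : LinearMap.ker T = ⊥ := by
    by_contra hne
    apply h0
    have := weyl_irreducible (b := b) hψ (LinearMap.ker T) (fun v f hf => by
      rw [LinearMap.mem_ker] at hf ⊢
      have := LinearMap.congr_fun (h v) f
      simp only [Module.End.mul_apply] at this
      rw [this, hf, map_zero]) hne
    exact LinearMap.ker_eq_top.mp this
  rw [Module.End.isUnit_iff]
  exact ⟨LinearMap.ker_eq_bot.mp hk, LinearMap.injective_iff_surjective.mp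
    (LinearMap.ker_eq_bot.mp hk)⟩

lemma Implements.eq_smul [Finite F] [Fintype P] [Fintype Q] [b.IsPerfPair] (hψ : ψ ≠ 1)
    {S : (P × Q) ≃ₗ[F] (P × Q)} {T T' : Module.End ℂ (Q → ℂ)} (h : Implements ψ b S T)
    (h' : Implements ψ b S T') (hu : IsUnit T) : ∃ c : ℂ, T' = c • T := by
  obtain ⟨u, rfl⟩ := hu
  set C : Module.End ℂ (Q → ℂ) := (↑u⁻¹ : Module.End ℂ (Q → ℂ)) * T' with hC
  have hcomm : ∀ v, C * weyl ψ b v = weyl ψ b v * C := by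
    intro v
    have h1 : (↑u⁻¹ : Module.End ℂ (Q → ℂ)) * weyl ψ b (S v) = weyl ψ b v * ↑u⁻¹ := by
      rw [Units.inv_mul_eq_iff_eq_mul, ← mul_assoc, h v, mul_assoc, u.mul_inv, mul_one]
    rw [hC, mul_assoc, h' v, ← mul_assoc, h1, mul_assoc]
  obtain ⟨c, hc⟩ := Module.End.exists_eigenvalue C
  refine ⟨c, ?_⟩
  have htop := weyl_irreducible (b := b) hψ (C.eigenspace c) (fun v f hf => by
    rw [Module.End.mem_eigenspace_iff] at hf ⊢
    have := LinearMap.congr_fun (hcomm v) f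
    simp only [Module.End.mul_apply] at this
    rw [this, hf, map_smul]) hc
  have : C = c • 1 := by
    ext1 f
    have : f ∈ C.eigenspace c := htop ▸ Submodule.mem_top
    simpa using Module.End.mem_eigenspace_iff.mp this
  rw [hC, Units.inv_mul_eq_iff_eq_mul] at this
  rw [this, mul_smul_comm, mul_one]

lemma sum_weyl [Finite F] [Fintype P] [Fintype Q] [hb : b.IsPerfPair] (hψ : ψ ≠ 1)
    (h2 : (2 : F) ≠ 0) :
    ∑ v : P × Q, weyl ψ b v = (Fintype.card P : ℂ) • parity Q := by
  classical
  refine LinearMap.ext fun f => funext fun q => ?_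
  simp only [LinearMap.coe_sum, Finset.sum_apply, weyl_apply, LinearMap.smul_apply,
    Pi.smul_apply, smul_eq_mul]
  rw [Fintype.sum_prod_type_right]
  have : ∀ y : Q, ∑ x : P, ψ (b x q - 2⁻¹ * b x y) * f (q - y) =
      if y = (2 : F) • q then (Fintype.card P : ℂ) * f (-q) else 0 := by
    intro y
    have h := sum_char_bilin hψ b hb.bijective_right.injective (q - (2⁻¹ : F) • y)
    have e : ∀ x : P, b x q - 2⁻¹ * b x y = b x (q - (2⁻¹ : F) • y) := by
      intro x; simp
    rw [← Finset.sum_mul]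
    simp only [e]
    rw [h]
    have e2 : q - (2⁻¹ : F) • y = 0 ↔ y = (2 : F) • q := by
      rw [sub_eq_zero, eq_comm, inv_smul_eq_iff₀ h2]
    simp only [e2]
    split_ifs with hy
    · rw [hy, two_smul]; congr 2; abel
    · simp
  simp only [this]
  simp [parity]

lemma Implements.comm_parity [Finite F] [Fintype P] [Fintype Q] [hb : b.IsPerfPair] (hψ : ψ ≠ 1)
    (h2 : (2 : F) ≠ 0) {S : (P × Q) ≃ₗ[F] (P × Q)} {T : Module.End ℂ (Q → ℂ)}
    (h : Implements ψ b S T) : Commute T (parity Q) := by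
  have h1 : T * ∑ v : P × Q, weyl ψ b v = (∑ v : P × Q, weyl ψ b v) * T := by
    rw [Finset.mul_sum, Finset.sum_mul]
    simp only [h _]
    exact Equiv.sum_comp S.toEquiv fun v => weyl ψ b v * T
  rw [sum_weyl hψ h2, mul_smul_comm, smul_mul_assoc] at h1
  exact smul_right_injective _ (r := (Fintype.card P : ℂ))
    (by exact_mod_cast Fintype.card_ne_zero) h1

lemma exists_implements [Finite F] [Fintype P] [Fintype Q] [hb : b.IsPerfPair] (hψ : ψ ≠ 1)
    (h2 : (2 : F) ≠ 0) (S : Sp b) :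
    ∃ T : Module.End ℂ (Q → ℂ), Implements ψ b S T ∧ T ≠ 0 := by
  classical
  let s : (P × Q) ≃ₗ[F] (P × Q) := S
  have hS : ∀ v w, symplecticForm b (s v) (s w) = symplecticForm b v w := S.2
  let av : Module.End ℂ (Q → ℂ) → Module.End ℂ (Q → ℂ) := fun M =>
    ∑ v, weyl ψ b (s v) * M * weyl ψ b (-v)
  have hav : ∀ M, Implements ψ b s (av M) := by
    intro M u
    have e1 : ∀ v, weyl ψ b (s u) * (weyl ψ b (s v) * M * weyl ψ b (-v)) =
        (weyl ψ b (s (u + v)) * M * weyl ψ b (-(u + v))) * weyl ψ b u := by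
      intro v
      rw [mul_assoc _ (weyl ψ b (-(u + v))), weyl_mul ψ b h2 (-(u + v)) u, ← mul_assoc,
        ← mul_assoc, weyl_mul ψ b h2 (s u) (s v), hS, ← map_add, mul_smul_comm]
      simp only [smul_mul_assoc]
      congr 2
      · congr 1
        simp only [map_neg, map_add, LinearMap.neg_apply, LinearMap.add_apply,
          symplecticForm_self, symplecticForm_swap b v u]
        ring
      · congr 1; abel
    simp only [av]
    rw [Finset.mul_sum, Finset.sum_mul]
    simp only [e1]
    exact (Equiv.sum_comp (Equiv.addLeft u)
      fun v => weyl ψ b (s v) * M * weyl ψ b (-v) * weyl ψ b u).symm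
  by_contra hcon
  push Not at hcon
  have h0 : ∀ M, av M = 0 := fun M => hcon _ (hav M)
  have h1 := weyl_indep (b := b) hψ h2
    (fun w => weyl ψ b (-(s.symm w)) (fun _ => 1) 0) (by
      refine LinearMap.ext fun g => ?_
      let M : Module.End ℂ (Q → ℂ) := (LinearMap.proj (R := ℂ) (φ := fun _ : Q => ℂ) 0).smulRight g
      have := LinearMap.congr_fun (h0 M) (fun _ => 1)
      simp only [av, LinearMap.coe_sum, Finset.sum_apply, Module.End.mul_apply,
        LinearMap.zero_apply, M, LinearMap.smulRight_apply, LinearMap.proj_apply, map_smul] at this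
      rw [LinearMap.zero_apply]
      refine Eq.trans ?_ this
      simp only [LinearMap.coe_sum, Finset.sum_apply, LinearMap.smul_apply]
      rw [← Equiv.sum_comp s.toEquiv]
      simp) 0
  simp [weyl_zero] at h1

lemma exists_unique_normalized [Finite F] [Fintype P] [Fintype Q] [hb : b.IsPerfPair] (hψ : ψ ≠ 1)
    (h2 : (2 : F) ≠ 0) (S : Sp b) :
    ∃! T : Module.End ℂ (Q → ℂ), Implements ψ b S T ∧ Normalized T := by
  obtain ⟨T, hT, h0⟩ := exists_implements hψ h2 S
  have hu := hT.isUnit hψ h0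
  have hc := hT.comm_parity hψ h2
  have hn : Normalized (detRatio T • T) :=
    (Normalized.smul_iff h2 hc hu (detRatio_ne_zero hc hu)).mpr rfl
  refine ⟨detRatio T • T, ⟨hT.smul _, hn⟩, ?_⟩
  rintro T' ⟨h', hn'⟩
  obtain ⟨c, hc'⟩ := (hT.smul (detRatio T)).eq_smul hψ h' hn.unit
  exact hn.eq_of_smul h2 hn' hc'

/-- The representation of the symplectic group by normalized operators. -/
noncomputable def normalizedRep [Finite F] [Fintype P] [Fintype Q] [hb : b.IsPerfPair]
    (hψ : ψ ≠ 1) (h2 : (2 : F) ≠ 0) : Representation ℂ (Sp b) (Q → ℂ) where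
  toFun S := (exists_unique_normalized hψ h2 S).choose
  map_one' := by
    have h := (exists_unique_normalized (b := b) hψ h2 1).choose_spec
    exact (h.2 1 ⟨fun v => by rw [one_mul, mul_one]; rfl, Normalized.one⟩).symm
  map_mul' S S' := by
    have h := (exists_unique_normalized (b := b) hψ h2 (S * S')).choose_spec
    have h1 := (exists_unique_normalized (b := b) hψ h2 S).choose_spec.1
    have h3 := (exists_unique_normalized (b := b) hψ h2 S').choose_spec.1
    exact (h.2 _ ⟨h1.1.mul h3.1, h1.2.mul h3.2⟩).symm

lemma normalizedRep_spec [Finite F] [Fintype P] [Fintype Q] [hb : b.IsPerfPair]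
    (hψ : ψ ≠ 1) (h2 : (2 : F) ≠ 0) (S : Sp b) :
    Implements ψ b S (normalizedRep hψ h2 S) ∧ Normalized (normalizedRep hψ h2 S) :=
  (exists_unique_normalized (b := b) hψ h2 S).choose_spec.1

lemma normalizedRep_eq [Finite F] [Fintype P] [Fintype Q] [hb : b.IsPerfPair]
    (hψ : ψ ≠ 1) (h2 : (2 : F) ≠ 0) (S : Sp b) {T : Module.End ℂ (Q → ℂ)}
    (h : Implements ψ b S T) (hT : Normalized T) : normalizedRep hψ h2 S = T :=
  ((exists_unique_normalized (b := b) hψ h2 S).choose_spec.2 T ⟨h, hT⟩).symm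

end Weyl

end CSSRep

namespace CSSRep

section Gauss

variable {F : Type*} [Field F] {Q : Type*} [AddCommGroup Q] [Module F Q]

/-- Multiplication by the quadratic phase `ψ(2⁻¹ β(q, q))`. -/
def chirp (ψ : AddChar F ℂ) (β : Q →ₗ[F] Q →ₗ[F] F) : Module.End ℂ (Q → ℂ) :=
  mulOp fun q => ψ (2⁻¹ * β q q)

/-- The unnormalized Fourier transform with kernel `ψ(β(q, r))`. -/
def fourier [Fintype Q] (ψ : AddChar F ℂ) (β : Q →ₗ[F] Q →ₗ[F] F) : Module.End ℂ (Q → ℂ) where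
  toFun f r := ∑ q, ψ (β q r) * f q
  map_add' f g := by ext r; simp [mul_add, Finset.sum_add_distrib]
  map_smul' c f := by
    ext r
    simp only [Pi.smul_apply, smul_eq_mul, RingHom.id_apply, Finset.mul_sum]
    exact Finset.sum_congr rfl fun q _ => by ring

/-- Composition with a linear map. -/
def pull (M : Q →ₗ[F] Q) : Module.End ℂ (Q → ℂ) where
  toFun f q := f (M q)
  map_add' _ _ := rfl
  map_smul' _ _ := rfl

/-- The Gauss sum of a form. -/
noncomputable def gaussForm [Fintype Q] (ψ : AddChar F ℂ) (β : Q →ₗ[F] Q →ₗ[F] F) : ℂ :=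
  ∑ q, ψ (-(2⁻¹ * β q q))

lemma pull_comm (M : Q →ₗ[F] Q) : Commute (pull M) (parity Q) := by
  ext f q; simp [pull, parity]

lemma pull_mul (M N : Q →ₗ[F] Q) : pull M * pull N = pull (N * M) := rfl

lemma pull_isUnit (M : Q ≃ₗ[F] Q) : IsUnit (pull (M : Q →ₗ[F] Q)) := by
  refine ⟨⟨pull (M : Q →ₗ[F] Q), pull (M.symm : Q →ₗ[F] Q), ?_, ?_⟩, rfl⟩ <;>
  · ext f q; simp [pull]

variable {ψ : AddChar F ℂ} {β : Q →ₗ[F] Q →ₗ[F] F}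

lemma chirp_normalized [Finite Q] (h2 : (2 : F) ≠ 0) : Normalized (chirp ψ β) where
  comm := mulOp_comm_parity fun q => by simp
  unit := by
    refine ⟨⟨chirp ψ β, mulOp fun q => ψ (-(2⁻¹ * β q q)), ?_, ?_⟩, rfl⟩ <;>
    · refine LinearMap.ext fun f => funext fun q => ?_
      simp [chirp, mulOp, ← mul_assoc, ← AddChar.map_add_eq_mul]
  det_eq := by
    rw [chirp, evenDet_mulOp h2]; simp

lemma fourier_comm [Fintype Q] : Commute (fourier ψ β) (parity Q) := by
  refine LinearMap.ext fun f => funext fun r => ?_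
  simp only [fourier, parity, Module.End.mul_apply, LinearMap.coe_mk, AddHom.coe_mk]
  rw [← Equiv.sum_comp (Equiv.neg Q)]
  simp

lemma fourier_mul [Finite F] [Fintype Q] (hψ : ψ ≠ 1) (hβ : Function.Injective β.flip)
    (β' : Q →ₗ[F] Q →ₗ[F] F) (M : Q ≃ₗ[F] Q) (h : ∀ q q', β' (M q) q' = - β q' q) :
    fourier ψ β * fourier ψ β' = (Fintype.card Q : ℂ) • pull (M : Q →ₗ[F] Q) := by
  classical
  refine LinearMap.ext fun f => funext fun r => ?_
  simp only [fourier, Module.End.mul_apply, LinearMap.coe_mk, AddHom.coe_mk, LinearMap.smul_apply,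
    Pi.smul_apply, pull, smul_eq_mul, Finset.mul_sum]
  rw [Finset.sum_comm, ← Equiv.sum_comp M.toEquiv]
  have : ∀ s : Q, ∑ x : Q, ψ (β x r) * (ψ (β' (M.toEquiv s) x) * f (M.toEquiv s)) =
      if s = r then (Fintype.card Q : ℂ) * f (M s) else 0 := by
    intro s
    have hs := sum_char_bilin hψ β hβ (r - s)
    have e : ∀ x, ψ (β x r) * (ψ (β' (M.toEquiv s) x) * f (M.toEquiv s)) =
        ψ (β x (r - s)) * f (M s) := by
      intro x
      have : M.toEquiv s = M s := rfl
      rw [this, h, ← mul_assoc, ← AddChar.map_add_eq_mul, map_sub, sub_eq_add_neg]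
    simp only [e]
    rw [← Finset.sum_mul, hs]
    simp only [sub_eq_zero, eq_comm (a := r)]
    split_ifs <;> simp
  simp only [this]
  simp

lemma gauss_identity [Finite F] [Fintype Q] (h2 : (2 : F) ≠ 0) (hs : ∀ x y, β x y = β y x) :
    gaussForm ψ β • (chirp ψ β * fourier ψ β * chirp ψ β) =
      fourier ψ β * chirp ψ (-β) * fourier ψ β := by
  refine LinearMap.ext fun f => funext fun r => ?_
  simp only [fourier, chirp, mulOp, Module.End.mul_apply, LinearMap.coe_mk, AddHom.coe_mk,
    LinearMap.smul_apply, Pi.smul_apply, smul_eq_mul, Finset.mul_sum]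
  rw [Finset.sum_comm]
  refine Finset.sum_congr rfl fun q _ => ?_
  rw [gaussForm, Finset.sum_mul, ← Equiv.sum_comp (Equiv.subRight (q + r))]
  refine Finset.sum_congr rfl fun a _ => ?_
  simp only [← mul_assoc, ← AddChar.map_add_eq_mul]
  congr 2
  simp only [Equiv.subRight_apply, map_sub, map_add, LinearMap.sub_apply, LinearMap.add_apply,
    LinearMap.neg_apply, hs q a, hs r a, hs r q]
  field_simp
  ring

lemma fourier_isUnit [Finite F] [Fintype Q] (hψ : ψ ≠ 1) (hβ : Function.Injective β.flip)
    (hs : ∀ x y, β x y = β y x) : IsUnit (fourier ψ β) := by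
  have hc : (Fintype.card Q : ℂ) ≠ 0 := by exact_mod_cast Fintype.card_ne_zero
  have h1 := fourier_mul hψ hβ (-β) (LinearEquiv.refl F Q) (by intro q q'; simp [hs q q'])
  have h : fourier ψ β * ((Fintype.card Q : ℂ)⁻¹ • fourier ψ (-β)) = 1 := by
    rw [mul_smul_comm, h1, smul_smul, inv_mul_cancel₀ hc, one_smul]; rfl
  have hsurj : Function.Surjective (fourier ψ β) := fun f =>
    ⟨((Fintype.card Q : ℂ)⁻¹ • fourier ψ (-β)) f, LinearMap.congr_fun h f⟩
  rw [Module.End.isUnit_iff]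
  exact ⟨LinearMap.injective_iff_surjective.mpr hsurj, hsurj⟩

lemma gaussForm_ne_zero [Finite F] [Fintype Q] (hψ : ψ ≠ 1) (h2 : (2 : F) ≠ 0)
    (hβ : Function.Injective β.flip)
    (hs : ∀ x y, β x y = β y x) : gaussForm ψ β ≠ 0 := by
  intro h0
  have h := gauss_identity (ψ := ψ) h2 hs
  rw [h0, zero_smul] at h
  have hu := fourier_isUnit hψ hβ hs
  have := (hu.mul (chirp_normalized (ψ := ψ) (β := -β) h2).unit).mul hu
  rw [← h] at this
  have h3 := LinearMap.congr_fun (isUnit_zero_iff.mp this) (fun _ => 1)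
  have h4 := congrFun h3 0
  simp at h4

lemma normalized_iff [Finite Q] (h2 : (2 : F) ≠ 0) {T : Module.End ℂ (Q → ℂ)}
    (hT : Commute T (parity Q)) (hu : IsUnit T) : Normalized T ↔ detRatio T = 1 := by
  have := Normalized.smul_iff h2 hT hu one_ne_zero
  rw [one_smul] at this
  rw [this, eq_comm]

lemma fourier_normalized [Finite F] [Fintype Q] (hψ : ψ ≠ 1) (h2 : (2 : F) ≠ 0)
    (hβ : Function.Injective β.flip)
    (hs : ∀ x y, β x y = β y x) : Normalized ((gaussForm ψ β)⁻¹ • fourier ψ β) := by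
  have hg := gaussForm_ne_zero hψ h2 hβ hs
  have hu := fourier_isUnit hψ hβ hs
  obtain ⟨u, hu'⟩ := hu
  have hcomm : Commute (fourier ψ β) (parity Q) := fourier_comm
  set G := (gaussForm ψ β)⁻¹ • fourier ψ β with hG
  have hGc : Commute G (parity Q) := hcomm.smul_left _
  have hGu : IsUnit G := (fourier_isUnit hψ hβ hs).smul (Units.mk0 _ (inv_ne_zero hg))
  have hN := chirp_normalized (ψ := ψ) (β := β) h2
  have hN' := chirp_normalized (ψ := ψ) (β := -β) h2
  have hK : Normalized (fourier ψ β * chirp ψ (-β) * (↑u⁻¹ : Module.End ℂ (Q → ℂ))) :=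
    hN'.conj hcomm (by rw [← hu', u.mul_inv]) (by rw [← hu', u.inv_mul])
  have hid : chirp ψ β * G * chirp ψ β =
      (fourier ψ β * chirp ψ (-β) * (↑u⁻¹ : Module.End ℂ (Q → ℂ))) * (G * G) := by
    have h := gauss_identity (ψ := ψ) h2 hs
    have h3 : fourier ψ β * chirp ψ (-β) * (↑u⁻¹ : Module.End ℂ (Q → ℂ)) *
        (fourier ψ β * fourier ψ β) = fourier ψ β * chirp ψ (-β) * fourier ψ β := by
      rw [mul_assoc, ← mul_assoc (↑u⁻¹ : Module.End ℂ (Q → ℂ)), ← hu', u.inv_mul, one_mul]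
    rw [hG]
    simp only [mul_smul_comm, smul_mul_assoc]
    rw [h3, ← h, smul_smul, smul_smul]
    congr 1
    field_simp
  have hd := congrArg detRatio hid
  rw [detRatio_mul _ hN.comm, detRatio_mul _ hGc, detRatio_mul _ (hGc.mul_left hGc),
    detRatio_mul _ hGc, (normalized_iff h2 hN.comm hN.unit).mp hN,
    (normalized_iff h2 hK.comm hK.unit).mp hK] at hd
  rw [normalized_iff h2 hGc hGu]
  have h0 := detRatio_ne_zero hGc hGu
  apply mul_left_cancel₀ h0
  linear_combination -hd

end Gauss

section Legendre

variable {F : Type*} [Field F]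

lemma legendre_eq [Fintype F] [DecidableEq F] {a : F} (ha : a ≠ 0) :
    legendre a = ((quadraticChar F a : ℤ) : ℂ) := by
  classical
  rw [legendre, quadraticChar_apply, quadraticCharFun, if_neg ha]
  split_ifs <;> simp

lemma legendre_mul [Finite F] {a c : F} (ha : a ≠ 0) (hc : c ≠ 0) :
    legendre (a * c) = legendre a * legendre c := by
  classical
  have := Fintype.ofFinite F
  rw [legendre_eq ha, legendre_eq hc, legendre_eq (mul_ne_zero ha hc), map_mul]; push_cast; rfl

lemma legendre_one : legendre (1 : F) = 1 := by
  simp [legendre]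

lemma legendre_sq (a : F) : legendre a * legendre a = 1 := by
  rw [legendre]; split_ifs <;> simp

lemma legendre_prod [Finite F] {ι : Type*} (s : Finset ι) (c : ι → F) (hc : ∀ i, c i ≠ 0) :
    legendre (∏ i ∈ s, c i) = ∏ i ∈ s, legendre (c i) := by
  classical
  induction s using Finset.induction_on with
  | empty => simp [legendre_one]
  | insert a s ha ih =>
    rw [Finset.prod_insert ha, Finset.prod_insert ha,
      legendre_mul (hc a) (Finset.prod_ne_zero_iff.mpr fun i _ => hc i), ih]

lemma sum_sq [Fintype F] (h2 : (2 : F) ≠ 0) {ψ : AddChar F ℂ} (hψ : ψ ≠ 1) {a : F} (ha : a ≠ 0) :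
    ∑ x : F, ψ (a * x ^ 2) = legendre a * ∑ x : F, ψ (x ^ 2) := by
  classical
  have hF : ringChar F ≠ 2 := by
    intro h
    apply h2
    have := CharP.cast_eq_zero F (ringChar F)
    rw [h] at this
    exact_mod_cast this
  let χ : MulChar F ℂ := (quadraticChar F).ringHomComp (Int.castRingHom ℂ)
  have key : ∀ c : F, c ≠ 0 → ∑ x : F, ψ (c * x ^ 2) = gaussSum χ (ψ.mulShift c) := by
    intro c hc
    have h1 : ∑ x : F, ψ (c * x ^ 2) =
        ∑ z : F, ((Finset.univ.filter fun x : F => x ^ 2 = z).card : ℂ) * ψ (c * z) := by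
      rw [← Finset.sum_fiberwise (s := Finset.univ) (g := fun x : F => x ^ 2)
        (f := fun x => ψ (c * x ^ 2))]
      refine Finset.sum_congr rfl fun z _ => ?_
      rw [← nsmul_eq_mul, ← Finset.sum_const]
      refine Finset.sum_congr rfl fun x hx => ?_
      rw [(Finset.mem_filter.mp hx).2]
    have h3 : ∀ z : F, ((Finset.univ.filter fun x : F => x ^ 2 = z).card : ℂ) = χ z + 1 := by
      intro z
      have := quadraticChar_card_sqrts hF z
      have e : ({x : F | x ^ 2 = z}.toFinset) = Finset.univ.filter fun x : F => x ^ 2 = z := by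
        ext; simp
      rw [e] at this
      have h4 := congrArg (Int.cast : ℤ → ℂ) this
      push_cast at h4
      exact h4
    have h5 : ∑ z : F, ψ (c * z) = 0 := by
      have h := sum_char_bilin hψ (LinearMap.mul F F) (n := c) (by
        rw [injective_iff_map_eq_zero]
        intro n hn
        simpa using LinearMap.congr_fun hn 1)
      simp only [LinearMap.mul_apply', if_neg hc] at h
      simpa only [mul_comm c] using h
    rw [h1, gaussSum]
    simp only [h3, add_mul, one_mul, Finset.sum_add_distrib, h5, add_zero]
    rfl
  have h := gaussSum_mulShift χ ψ (Units.mk0 a ha)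
  have k1 := key 1 one_ne_zero
  simp only [one_mul, AddChar.mulShift_one] at k1
  rw [k1, key a ha, ← h]
  have : χ (Units.mk0 a ha : Fˣ) = legendre a := by
    rw [legendre_eq ha]; rfl
  rw [this, ← mul_assoc, legendre_sq, one_mul]
  rfl

lemma sum_sq_ne_zero [Fintype F] (h2 : (2 : F) ≠ 0) {ψ : AddChar F ℂ} (hψ : ψ ≠ 1) {a : F}
    (ha : a ≠ 0) : ∑ x : F, ψ (-(2⁻¹ * (a * x * x))) ≠ 0 := by
  have h := gaussForm_ne_zero (β := a • LinearMap.mul F F) hψ h2 (by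
    rw [injective_iff_map_eq_zero]
    intro n hn
    have := LinearMap.congr_fun hn 1
    simpa [ha] using this) (by intro x y; simp [mul_comm x y])
  simpa [gaussForm, mul_assoc] using h

lemma sum_sq' [Fintype F] (h2 : (2 : F) ≠ 0) {ψ : AddChar F ℂ} (hψ : ψ ≠ 1) {a : F} (ha : a ≠ 0) :
    ∑ x : F, ψ (-(2⁻¹ * (-a * x * x))) = legendre a * ∑ x : F, ψ (-(2⁻¹ * (-1 * x * x))) := by
  have e : ∀ c x : F, -(2⁻¹ * (-c * x * x)) = (2⁻¹ * c) * x ^ 2 := by intros; ring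
  simp only [e]
  have hi : (2 : F)⁻¹ ≠ 0 := inv_ne_zero h2
  rw [sum_sq h2 hψ (mul_ne_zero hi ha), sum_sq h2 hψ (mul_ne_zero hi one_ne_zero),
    legendre_mul hi ha, mul_one]
  ring

end Legendre

section Levi

variable {F : Type*} [Field F] {Q : Type*} [AddCommGroup Q] [Module F Q]
  {ι : Type*} [Fintype ι]

/-- The diagonal form with respect to a basis. -/
noncomputable def diagForm (v : Module.Basis ι F Q) (c : ι → F) : Q →ₗ[F] Q →ₗ[F] F :=
  LinearMap.mk₂ F (fun x y => ∑ i, c i * v.repr x i * v.repr y i)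
    (by intros; simp [mul_add, add_mul, Finset.sum_add_distrib])
    (by intros; simp only [map_smul, Finsupp.smul_apply, smul_eq_mul, Finset.mul_sum]
        exact Finset.sum_congr rfl fun _ _ => by ring)
    (by intros; simp [mul_add, Finset.sum_add_distrib])
    (by intros; simp only [map_smul, Finsupp.smul_apply, smul_eq_mul, Finset.mul_sum]
        exact Finset.sum_congr rfl fun _ _ => by ring)

lemma diagForm_apply (v : Module.Basis ι F Q) (c : ι → F) (x y : Q) :
    diagForm v c x y = ∑ i, c i * v.repr x i * v.repr y i := rfl

lemma diagForm_symm (v : Module.Basis ι F Q) (c : ι → F) (x y : Q) :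
    diagForm v c x y = diagForm v c y x := by
  simp only [diagForm_apply]; exact Finset.sum_congr rfl fun _ _ => by ring

lemma diagForm_injective (v : Module.Basis ι F Q) {c : ι → F} (hc : ∀ i, c i ≠ 0) :
    Function.Injective (diagForm v c).flip := by
  classical
  rw [injective_iff_map_eq_zero]
  intro y hy
  apply v.repr.injective
  ext i
  have := LinearMap.congr_fun hy (v i)
  simpa [diagForm_apply, Finsupp.single_apply, hc i] using this

lemma gaussForm_diag [Finite F] [Fintype F] [Fintype Q] (ψ : AddChar F ℂ)
    (v : Module.Basis ι F Q) (c : ι → F) :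
    gaussForm ψ (diagForm v c) = ∏ i, ∑ x : F, ψ (-(2⁻¹ * (c i * x * x))) := by
  classical
  rw [Finset.prod_univ_sum, Fintype.piFinset_univ, gaussForm]
  rw [← Equiv.sum_comp v.equivFun.toEquiv]
  refine Finset.sum_congr rfl fun q _ => ?_
  rw [diagForm_apply, Finset.mul_sum, ← Finset.sum_neg_distrib]
  have hmap : ∀ (s : Finset ι) (a : ι → F), ψ (∑ i ∈ s, a i) = ∏ i ∈ s, ψ (a i) := by
    intro s a
    induction s using Finset.induction_on with
    | empty => simp
    | insert i s hi ih =>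
      rw [Finset.sum_insert hi, Finset.prod_insert hi, AddChar.map_add_eq_mul, ih]
  rw [hmap]
  rfl

lemma detRatio_diag [Finite F] [Fintype Q] [DecidableEq ι] (h2 : (2 : F) ≠ 0) {ψ : AddChar F ℂ}
    (hψ : ψ ≠ 1) (v : Module.Basis ι F Q) {c : ι → F} (hc : ∀ i, c i ≠ 0) :
    detRatio (pull (Matrix.toLin v v (Matrix.diagonal c))) = legendre (∏ i, c i) := by
  have := Fintype.ofFinite F
  have hcard : (Fintype.card Q : ℂ) ≠ 0 := by exact_mod_cast Fintype.card_ne_zero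
  have main : ∀ c : ι → F, (∀ i, c i ≠ 0) →
      detRatio (pull (Matrix.toLin v v (Matrix.diagonal c))) =
        (Fintype.card Q : ℂ) * ((gaussForm ψ (diagForm v (-c)))⁻¹ *
          (gaussForm ψ (diagForm v (fun _ => 1)))⁻¹) := by
    intro c hc
    have hdet : IsUnit (LinearMap.det (Matrix.toLin v v (Matrix.diagonal c))) := by
      rw [LinearMap.det_toLin, Matrix.det_diagonal, isUnit_iff_ne_zero]
      exact Finset.prod_ne_zero_iff.mpr fun i _ => hc i
    let M : Q ≃ₗ[F] Q := LinearEquiv.ofIsUnitDet (v := v) (v' := v)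
      (f := Matrix.toLin v v (Matrix.diagonal c)) (by
        rw [LinearMap.toMatrix_toLin, Matrix.det_diagonal, isUnit_iff_ne_zero]
        exact Finset.prod_ne_zero_iff.mpr fun i _ => hc i)
    have hM : (M : Q →ₗ[F] Q) = Matrix.toLin v v (Matrix.diagonal c) := rfl
    have hrepr : ∀ q i, v.repr (M q) i = c i * v.repr q i := by
      intro q i
      change v.repr (Matrix.toLin v v (Matrix.diagonal c) q) i = _
      rw [Matrix.repr_toLin, Matrix.mulVec_diagonal]
    have hc' : ∀ i, (-c) i ≠ 0 := fun i => neg_ne_zero.mpr (hc i)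
    have hm := fourier_mul hψ (diagForm_injective v hc') (diagForm v fun _ => 1) M (by
      intro q q'
      simp only [diagForm_apply, hrepr, ← Finset.sum_neg_distrib]
      exact Finset.sum_congr rfl fun i _ => by simp; ring)
    have n1 := fourier_normalized hψ h2 (diagForm_injective v hc') (diagForm_symm v (-c))
    have n2 := fourier_normalized hψ h2
      (diagForm_injective v (c := fun _ => 1) fun _ => one_ne_zero) (diagForm_symm v _)
    have n3 := n1.mul n2
    rw [smul_mul_smul_comm, hm, smul_smul] at n3
    have g1 := gaussForm_ne_zero hψ h2 (diagForm_injective v hc') (diagForm_symm v (-c))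
    have g2 := gaussForm_ne_zero hψ h2
      (diagForm_injective v (c := fun _ => 1) fun _ => one_ne_zero) (diagForm_symm v _)
    rw [hM] at n3
    rw [← (Normalized.smul_iff h2 (pull_comm _) (hM ▸ pull_isUnit M)
      (mul_ne_zero (mul_ne_zero (inv_ne_zero g1) (inv_ne_zero g2)) hcard)).mp n3]
    ring
  have m1 := main c hc
  have m2 := main (fun _ => 1) fun _ => one_ne_zero
  have e1 : pull (Matrix.toLin v v (Matrix.diagonal fun _ => (1 : F))) = 1 := by
    rw [Matrix.diagonal_one, Matrix.toLin_one]; rfl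
  rw [e1, (normalized_iff h2 (Commute.one_left _) isUnit_one).mp Normalized.one] at m2
  have g1 := gaussForm_ne_zero hψ h2 (diagForm_injective v (c := -c)
    fun i => neg_ne_zero.mpr (hc i)) (diagForm_symm v (-c))
  have g2 := gaussForm_ne_zero hψ h2
      (diagForm_injective v (c := fun _ => 1) fun _ => one_ne_zero) (diagForm_symm v _)
  have g3 := gaussForm_ne_zero hψ h2
      (diagForm_injective v (c := -fun _ => 1) fun _ => neg_ne_zero.mpr one_ne_zero)
      (diagForm_symm v _)
  have hg : gaussForm ψ (diagForm v (-c)) =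
      legendre (∏ i, c i) * gaussForm ψ (diagForm v (-fun _ => 1)) := by
    rw [gaussForm_diag, gaussForm_diag, legendre_prod _ _ hc, ← Finset.prod_mul_distrib]
    refine Finset.prod_congr rfl fun i _ => ?_
    simpa using sum_sq' h2 hψ (hc i)
  have hl := legendre_sq (∏ i, c i)
  have hl0 : legendre (∏ i, c i) ≠ 0 := left_ne_zero_of_mul (hl ▸ one_ne_zero)
  rw [m1, hg]
  have m3 : (Fintype.card Q : ℂ) = gaussForm ψ (diagForm v (-fun _ => 1)) *
      gaussForm ψ (diagForm v (fun _ => 1)) := by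
    field_simp at m2
    rw [← m2]
  rw [m3]
  field_simp
  rw [pow_two, hl]

lemma detRatio_pull_mul (M N : Q →ₗ[F] Q) :
    detRatio (pull (M * N)) = detRatio (pull M) * detRatio (pull N) := by
  rw [← pull_mul, detRatio_mul _ (pull_comm _), mul_comm]

lemma detRatio_transvection [Finite F] [Fintype Q] [DecidableEq ι] (h2 : (2 : F) ≠ 0)
    (v : Module.Basis ι F Q) (t : Matrix.TransvectionStruct ι F) :
    detRatio (pull (Matrix.toLin v v t.toMatrix)) = 1 := by
  let κ : Matrix ι ι F → ℂ := fun M => detRatio (pull (Matrix.toLin v v M))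
  have hκ : ∀ A B, κ (A * B) = κ A * κ B := by
    intro A B
    simp only [κ]
    rw [Matrix.toLin_mul v v v]
    exact detRatio_pull_mul _ _
  have hne : ∀ A : Matrix ι ι F, A.det ≠ 0 → κ A ≠ 0 := by
    intro A hA
    let M : Q ≃ₗ[F] Q := LinearEquiv.ofIsUnitDet (v := v) (v' := v)
      (f := Matrix.toLin v v A) (by
        rw [LinearMap.toMatrix_toLin, isUnit_iff_ne_zero]; exact hA)
    exact detRatio_ne_zero (pull_comm _) (pull_isUnit M)
  obtain ⟨i, j, hij, a⟩ := t
  change κ (Matrix.transvection i j a) = 1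
  let D : Matrix ι ι F := Matrix.diagonal (Function.update 1 i 2)
  have hD : D * Matrix.transvection i j a =
      Matrix.transvection i j a * Matrix.transvection i j a * D := by
    rw [Matrix.transvection_mul_transvection_same i j hij]
    ext k l
    simp only [D, Matrix.diagonal_mul, Matrix.mul_diagonal, Matrix.transvection, Matrix.add_apply,
      Matrix.one_apply, Matrix.single_apply, Function.update_apply, Pi.one_apply]
    by_cases hk : k = i <;> by_cases hl : l = j <;> by_cases hkl : k = l <;>
      subst_vars <;> simp_all [eq_comm] <;> ring
  have h := congrArg κ hD
  rw [hκ, hκ, hκ] at h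
  have d1 : κ D ≠ 0 := by
    apply hne
    rw [Matrix.det_diagonal]
    refine Finset.prod_ne_zero_iff.mpr fun k _ => ?_
    by_cases hk : k = i
    · subst hk; simpa using h2
    · simp [hk]
  have d2 : κ (Matrix.transvection i j a) ≠ 0 := by
    apply hne
    rw [Matrix.det_transvection_of_ne i j hij]; exact one_ne_zero
  apply mul_left_cancel₀ (mul_ne_zero d1 d2)
  linear_combination -h

lemma detRatio_pull [Finite F] [Fintype Q] (h2 : (2 : F) ≠ 0) {ψ : AddChar F ℂ}
    (hψ : ψ ≠ 1) (M : Q ≃ₗ[F] Q) :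
    detRatio (pull (M : Q →ₗ[F] Q)) = legendre (LinearMap.det (M : Q →ₗ[F] Q)) := by
  classical
  have : Module.Finite F Q := Module.Finite.of_finite
  let v := Module.finBasis F Q
  suffices h : ∀ A : Matrix (Fin (Module.finrank F Q)) (Fin (Module.finrank F Q)) F, A.det ≠ 0 →
      detRatio (pull (Matrix.toLin v v A)) = legendre A.det by
    have h1 := h (LinearMap.toMatrix v v (M : Q →ₗ[F] Q)) (by
      rw [LinearMap.det_toMatrix]
      exact M.isUnit_det'.ne_zero)
    rwa [Matrix.toLin_toMatrix, LinearMap.det_toMatrix] at h1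
  intro A hA
  refine Matrix.diagonal_transvection_induction_of_det_ne_zero
    (fun A => detRatio (pull (Matrix.toLin v v A)) = legendre A.det) A hA ?_ ?_ ?_
  · intro D hD
    rw [Matrix.det_diagonal] at hD ⊢
    exact detRatio_diag h2 hψ v fun i => Finset.prod_ne_zero_iff.mp hD i (Finset.mem_univ i)
  · intro t
    rw [detRatio_transvection h2, Matrix.TransvectionStruct.det, legendre_one]
  · intro A B hA hB h h'
    rw [Matrix.det_mul, legendre_mul hA hB, ← h, ← h', Matrix.toLin_mul v v v]
    exact detRatio_pull_mul _ _

end Levi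

section Existence

variable {F : Type*} [Field F] {P Q : Type*} [AddCommGroup P] [Module F P]
  [AddCommGroup Q] [Module F Q] {ψ : AddChar F ℂ} {b : P →ₗ[F] Q →ₗ[F] F}

lemma normalizedRep_isOscillator [Finite F] [Fintype P] [Fintype Q] [hb : b.IsPerfPair]
    (hψ : ψ ≠ 1) (h2 : (2 : F) ≠ 0) : IsOscillator ψ b (normalizedRep hψ h2) where
  map_weyl S v := (normalizedRep_spec hψ h2 S).1 v
  map_N := by
    intro S A hS f y
    have hsym : ∀ y y', b (A y) y' = b (A y') y := by
      intro y y'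
      have := S.2 (0, y) (0, y')
      rw [symplecticForm_apply, symplecticForm_apply, hS, hS] at this
      simpa [sub_eq_zero] using this
    have himp : Implements ψ b S (chirp ψ (b.comp A)) := by
      rintro ⟨x, y⟩
      refine LinearMap.ext fun f => funext fun q => ?_
      rw [hS]
      simp only [chirp, mulOp, Module.End.mul_apply, weyl_apply, LinearMap.coe_mk, AddHom.coe_mk,
        ← mul_assoc, ← AddChar.map_add_eq_mul, LinearMap.comp_apply]
      congr 2
      simp only [map_add, map_sub, LinearMap.add_apply, LinearMap.sub_apply, hsym q y]
      field_simp
      ring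
    rw [normalizedRep_eq hψ h2 S himp (chirp_normalized h2)]
    rfl
  map_J := by
    intro S B hS f y'
    have hsym : ∀ y y', b (B y) y' = b (B y') y := by
      intro y y'
      have := S.2 (0, y) (B y', 0)
      rw [symplecticForm_apply, symplecticForm_apply, hS, hS] at this
      simpa using this
    let β : Q →ₗ[F] Q →ₗ[F] F := b.comp (B : Q →ₗ[F] P)
    have hβ : Function.Injective β.flip := by
      rw [injective_iff_map_eq_zero]
      intro n hn
      apply B.injective
      apply hb.bijective_left.injective
      rw [map_zero, map_zero]
      ext q
      rw [hsym]
      exact LinearMap.congr_fun hn q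
    have himp : Implements ψ b S ((gaussForm ψ β)⁻¹ • fourier ψ β) := by
      apply Implements.smul
      rintro ⟨x, y⟩
      refine LinearMap.ext fun f => funext fun r => ?_
      rw [hS]
      simp only [fourier, Module.End.mul_apply, weyl_apply, LinearMap.coe_mk, AddHom.coe_mk,
        Finset.mul_sum]
      rw [← Equiv.sum_comp (Equiv.addRight y)]
      refine Finset.sum_congr rfl fun q _ => ?_
      have e : b (B q) (B.symm x) = b x q := by rw [hsym]; simp
      have e' : b (B y) (B.symm x) = b x y := by rw [hsym]; simp
      simp only [← mul_assoc, ← AddChar.map_add_eq_mul, Equiv.coe_addRight, β,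
        LinearMap.comp_apply, LinearEquiv.coe_coe, map_add, LinearMap.add_apply, sub_neg_eq_add,
        map_neg, e, e', add_sub_cancel_right]
      congr 2
      field_simp
      ring
    have hn := fourier_normalized hψ h2 hβ hsym
    rw [normalizedRep_eq hψ h2 S himp hn]
    simp only [LinearMap.smul_apply, Pi.smul_apply, smul_eq_mul, gauss,
      finsum_eq_sum_of_fintype]
    rfl
  map_D := by
    intro S C D hS f y
    have hCD : ∀ x y, b (C x) (D y) = b x y := by
      intro x y
      have := S.2 (x, 0) (0, y)
      rw [symplecticForm_apply, symplecticForm_apply, hS, hS] at this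
      simpa using this
    have himp : Implements ψ b S (detRatio (pull (D.symm : Q →ₗ[F] Q)) •
        pull (D.symm : Q →ₗ[F] Q)) := by
      apply Implements.smul
      rintro ⟨x, y⟩
      refine LinearMap.ext fun f => funext fun q => ?_
      rw [hS]
      simp only [pull, Module.End.mul_apply, weyl_apply, LinearMap.coe_mk, AddHom.coe_mk,
        LinearEquiv.coe_coe, map_sub, LinearEquiv.symm_apply_apply, hCD]
      congr 3
      rw [← hCD, D.apply_symm_apply]
    have hn : Normalized (detRatio (pull (D.symm : Q →ₗ[F] Q)) • pull (D.symm : Q →ₗ[F] Q)) :=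
      (Normalized.smul_iff h2 (pull_comm _) (pull_isUnit _)
        (detRatio_ne_zero (pull_comm _) (pull_isUnit _))).mpr rfl
    rw [normalizedRep_eq hψ h2 S himp hn, detRatio_pull h2 hψ]
    have hdet : LinearMap.det (D.symm : Q →ₗ[F] Q) = LinearMap.det (C : P →ₗ[F] P) := by
      have : Module.Finite F P := Module.Finite.of_finite
      have : Module.Finite F Q := Module.Finite.of_finite
      have h := LinearMap.det_conj (C : P →ₗ[F] P) b.toPerfPair
      rw [← h, ← LinearMap.det_dualMap]
      congr 1
      ext φ q
      obtain ⟨x, rfl⟩ := b.toPerfPair.surjective φ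
      have hx : b.toPerfPair.symm (b x) = x := b.toPerfPair.symm_apply_apply x
      simp [← hCD x, hx]
    rw [hdet]
    simp [pull]

theorem exists_isOscillator [Finite F] [Module.Finite F P] [Module.Finite F Q] [b.IsPerfPair]
    (hψ : ψ ≠ 1) (h2 : (2 : F) ≠ 0) : ∃ μ, IsOscillator ψ b μ := by
  have : Finite P := Module.finite_of_finite F
  have : Finite Q := Module.finite_of_finite F
  have := Fintype.ofFinite P
  have := Fintype.ofFinite Q
  exact ⟨_, normalizedRep_isOscillator hψ h2⟩

end Existence

end CSSRep

namespace CSSRep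

open scoped TensorProduct

section Oscillator

lemma two_ne_zero_of_odd {p : ℕ} [hp : Fact p.Prime] (hp2 : p ≠ 2) (F : Type*) [Field F]
    [Algebra (ZMod p) F] : (2 : F) ≠ 0 := by
  have : CharP F p := charP_of_injective_algebraMap (algebraMap (ZMod p) F).injective p
  intro h
  have h' : ((2 : ℕ) : F) = 0 := by exact_mod_cast h
  rw [CharP.cast_eq_zero_iff F p] at h'
  exact hp2 ((Nat.prime_dvd_prime_iff_eq hp.out Nat.prime_two).mp h')

/-- The character `ω(c) = exp(2πi Tr(c) / p)` of `F`, where `Tr` is the trace from `F` to its prime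
field. -/
noncomputable def omega (p : ℕ) [Fact p.Prime] (F : Type*) [Field F] [Algebra (ZMod p) F] :
    AddChar F ℂ :=
  ZMod.stdAddChar.compAddMonoidHom (Algebra.trace (ZMod p) F).toAddMonoidHom

lemma omega_apply (p : ℕ) [Fact p.Prime] (F : Type*) [Field F] [Algebra (ZMod p) F] (c : F) :
    omega p F c = Complex.exp (2 * Real.pi * Complex.I * (Algebra.trace (ZMod p) F c).val / p) := by
  have h := ZMod.stdAddChar_coe (N := p) ((Algebra.trace (ZMod p) F c).val : ℤ)
  simp only [Int.cast_natCast, ZMod.natCast_val, ZMod.cast_id', id] at h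
  simpa [omega] using h

lemma omega_ne_one (p : ℕ) [Fact p.Prime] (F : Type*) [Field F] [Finite F] [Algebra (ZMod p) F] :
    omega p F ≠ 1 := by
  intro h
  have : FiniteDimensional (ZMod p) F := Module.Finite.of_finite
  obtain ⟨c, hc⟩ : ∃ c, Algebra.trace (ZMod p) F c ≠ 0 := by
    by_contra hcon
    push Not at hcon
    exact Algebra.trace_ne_zero (ZMod p) F (LinearMap.ext hcon)
  apply hc
  apply ZMod.injective_stdAddChar
  have := DFunLike.congr_fun h c
  rw [AddChar.map_zero_eq_one]
  exact this

/-- The oscillator representation of the symplectic group of `P ⊕ Q` on `L²(Q)`, for spaces `P` and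
`Q` over a finite field of odd characteristic `p` that are in duality through `b`. -/
noncomputable def oscillatorRep {p : ℕ} [Fact p.Prime] (hp : p ≠ 2) {F : Type*} [Field F] [Finite F]
    [Algebra (ZMod p) F] {P Q : Type*} [AddCommGroup P] [Module F P] [Module.Finite F P]
    [AddCommGroup Q] [Module F Q] [Module.Finite F Q] (b : P →ₗ[F] Q →ₗ[F] F) [b.IsPerfPair] :
    Representation ℂ (Sp b) (Q → ℂ) :=
  (exists_isOscillator (b := b) (omega_ne_one p F) (two_ne_zero_of_odd hp F)).choose

theorem oscillatorRep_spec {p : ℕ} [Fact p.Prime] (hp : p ≠ 2) {F : Type*} [Field F] [Finite F]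
    [Algebra (ZMod p) F] {P Q : Type*} [AddCommGroup P] [Module F P] [Module.Finite F P]
    [AddCommGroup Q] [Module F Q] [Module.Finite F Q] (b : P →ₗ[F] Q →ₗ[F] F) [b.IsPerfPair] :
    IsOscillator (omega p F) b (oscillatorRep hp b) :=
  (exists_isOscillator (b := b) (omega_ne_one p F) (two_ne_zero_of_odd hp F)).choose_spec

end Oscillator

section Tensor

variable {F : Type*} [Field F] {X U : Type*} [AddCommGroup X] [Module F X] [Module.Finite F X]
  [AddCommGroup U] [Module F U] [Module.Finite F U]

/-- The pairing `⟨u ⊗ x, G⟩ = β(u, G x)` between `U ⊗ X` and `Hom(X → U) = U ⊗ X*`. -/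
noncomputable def tensorPairing (X : Type*) [AddCommGroup X] [Module F X]
    (β : LinearMap.BilinForm F U) :
    (U ⊗[F] X) →ₗ[F] (X →ₗ[F] U) →ₗ[F] F :=
  TensorProduct.lift <| LinearMap.mk₂ F
    (fun u x => (β u).comp (LinearMap.applyₗ x : (X →ₗ[F] U) →ₗ[F] U))
    (by intros; ext; simp) (by intros; ext; simp) (by intros; ext; simp) (by intros; ext; simp)

@[simp] lemma tensorPairing_tmul (β : LinearMap.BilinForm F U) (u : U) (x : X) (G : X →ₗ[F] U) :
    tensorPairing X β (u ⊗ₜ x) G = β u (G x) := rfl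

lemma tensorPairing_isPerfPair {β : LinearMap.BilinForm F U} (hn : β.Nondegenerate) :
    (tensorPairing X β).IsPerfPair := by
  have hinj : Function.Injective (tensorPairing X β).flip := by
    rw [injective_iff_map_eq_zero]
    intro G hG
    ext x
    apply hn.2
    intro u
    exact LinearMap.congr_fun hG (u ⊗ₜ x)
  have hdim : Module.finrank F (X →ₗ[F] U) = Module.finrank F (Module.Dual F (U ⊗[F] X)) := by
    rw [Subspace.dual_finrank_eq, Module.finrank_tensorProduct, Module.finrank_linearMap, mul_comm]
  have hbij : Function.Bijective (tensorPairing X β).flip :=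
    ⟨hinj, (LinearMap.injective_iff_surjective_of_finrank_eq_finrank hdim).mp hinj⟩
  exact (LinearMap.IsPerfPair.of_bijective _ hbij).flip

/-- The canonical isomorphism `U ⊗ V ≃ (U ⊗ X) ⊕ Hom(X → U)` for `V = X ⊕ X*`. -/
noncomputable def tensorEquiv (F X U : Type*) [Field F] [AddCommGroup X] [Module F X]
    [Module.Finite F X] [AddCommGroup U] [Module F U] :
    (U ⊗[F] (X × Module.Dual F X)) ≃ₗ[F] (U ⊗[F] X) × (X →ₗ[F] U) :=
  (TensorProduct.prodRight F F U X (Module.Dual F X)).trans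
    ((LinearEquiv.refl F (U ⊗[F] X)).prodCongr
      ((TensorProduct.comm F U (Module.Dual F X)).trans (dualTensorHomEquiv F X U)))

lemma tensorEquiv_tmul (u : U) (x : X) (y : Module.Dual F X) :
    tensorEquiv F X U (u ⊗ₜ (x, y)) = (u ⊗ₜ x, y.smulRight u) := by
  ext <;> simp [tensorEquiv, dualTensorHomEquiv]

lemma symplecticForm_tensor {β : LinearMap.BilinForm F U} (hs : β.IsSymm)
    (u u' : U) (v v' : X × Module.Dual F X) :
    symplecticForm (tensorPairing X β) (tensorEquiv F X U (u ⊗ₜ v)) (tensorEquiv F X U (u' ⊗ₜ v')) =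
      β u u' * symplecticForm (Module.Dual.eval F X) v v' := by
  obtain ⟨x, y⟩ := v
  obtain ⟨x', y'⟩ := v'
  have : β u u' = β u' u := hs.eq u u'
  simp [tensorEquiv_tmul, symplecticForm_apply, this]
  ring

/-- The automorphism `g ⊗ S` of `U ⊗ V`, seen on `(U ⊗ X) ⊕ Hom(X → U)`. -/
noncomputable def tensorAut (g : U ≃ₗ[F] U)
    (S : (X × Module.Dual F X) ≃ₗ[F] (X × Module.Dual F X)) :
    ((U ⊗[F] X) × (X →ₗ[F] U)) ≃ₗ[F] ((U ⊗[F] X) × (X →ₗ[F] U)) :=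
  ((tensorEquiv F X U).symm.trans (TensorProduct.congr g S)).trans (tensorEquiv F X U)

lemma tensorAut_apply (g : U ≃ₗ[F] U) (S : (X × Module.Dual F X) ≃ₗ[F] (X × Module.Dual F X))
    (t : U ⊗[F] (X × Module.Dual F X)) :
    tensorAut g S (tensorEquiv F X U t) = tensorEquiv F X U (TensorProduct.congr g S t) := by
  simp [tensorAut]

lemma tensorAut_mul (g g' : U ≃ₗ[F] U)
    (S S' : (X × Module.Dual F X) ≃ₗ[F] (X × Module.Dual F X)) :
    tensorAut (g * g') (S * S') = tensorAut g S * tensorAut g' S' := by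
  ext1 w
  obtain ⟨t, rfl⟩ := (tensorEquiv F X U).surjective w
  rw [LinearEquiv.mul_apply, tensorAut_apply, tensorAut_apply, tensorAut_apply]
  congr 1
  induction t using TensorProduct.induction_on with
  | zero => simp
  | add a b ha hb => simp only [map_add, ha, hb]
  | tmul u v => simp [TensorProduct.congr_tmul]

lemma tensorAut_one : tensorAut (1 : U ≃ₗ[F] U)
    (1 : (X × Module.Dual F X) ≃ₗ[F] (X × Module.Dual F X)) = 1 := by
  ext1 w
  obtain ⟨t, rfl⟩ := (tensorEquiv F X U).surjective w
  rw [tensorAut_apply, LinearEquiv.coe_one, id]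
  congr 1
  induction t using TensorProduct.induction_on with
  | zero => simp
  | add a b ha hb => simp only [map_add, ha, hb]
  | tmul u v => simp [TensorProduct.congr_tmul]

lemma tensorAut_mem {β : LinearMap.BilinForm F U} (hs : β.IsSymm) (g : isometryGroup β)
    (S : Sp (Module.Dual.eval F X)) :
    tensorAut (g : U ≃ₗ[F] U) (S : (X × Module.Dual F X) ≃ₗ[F] (X × Module.Dual F X)) ∈
      Sp (tensorPairing X β) := by
  intro w w'
  obtain ⟨t, rfl⟩ := (tensorEquiv F X U).surjective w
  obtain ⟨t', rfl⟩ := (tensorEquiv F X U).surjective w'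
  rw [tensorAut_apply, tensorAut_apply]
  induction t using TensorProduct.induction_on with
  | zero => simp
  | add a b ha hb => simp only [map_add, LinearMap.add_apply, ha, hb]
  | tmul u v =>
    induction t' using TensorProduct.induction_on with
    | zero => simp
    | add a b ha hb => simp only [map_add, ha, hb]
    | tmul u' v' =>
      rw [TensorProduct.congr_tmul, TensorProduct.congr_tmul, symplecticForm_tensor hs,
        symplecticForm_tensor hs, g.2 u u', S.2 v v']

/-- The embedding `(g, S) ↦ g ⊗ S` of `O(U) × Sp(V)` into `Sp(U ⊗ V)`. -/
noncomputable def tensorEmbedding {β : LinearMap.BilinForm F U} (hs : β.IsSymm) :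
    isometryGroup β × Sp (Module.Dual.eval F X) →* Sp (tensorPairing X β) where
  toFun g := ⟨tensorAut g.1 g.2, tensorAut_mem hs g.1 g.2⟩
  map_one' := Subtype.ext tensorAut_one
  map_mul' g h := Subtype.ext (tensorAut_mul g.1.1 h.1.1 g.2.1 h.2.1)

/-- `μ_{U ⊗ V}` as a representation of `O(U) × Sp(V)` on `L²(Hom(X → U))`, where
`V = X ⊕ X*`. -/
noncomputable def tensorRep (X : Type*) [AddCommGroup X] [Module F X] [Module.Finite F X]
    {p : ℕ} [Fact p.Prime] (hp : p ≠ 2) [Finite F] [Algebra (ZMod p) F]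
    {β : LinearMap.BilinForm F U} (hs : β.IsSymm) (hn : β.Nondegenerate) :
    Representation ℂ (isometryGroup β × Sp (Module.Dual.eval F X)) ((X →ₗ[F] U) → ℂ) :=
  haveI := tensorPairing_isPerfPair (X := X) hn
  (oscillatorRep hp (tensorPairing X β)).comp (tensorEmbedding hs)

end Tensor

section Discriminant

variable {F : Type*} [Field F] {U : Type*} [AddCommGroup U] [Module F U]

/-- The group of square classes of `F`. -/
abbrev SquareClass (F : Type*) [Field F] : Type _ := Fˣ ⧸ (powMonoidHom 2 : Fˣ →* Fˣ).range

/-- The square class of the Gram determinant of a non-degenerate form in a basis. -/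
noncomputable def gramClass {β : LinearMap.BilinForm F U} (hn : β.Nondegenerate)
    {ι : Type*} [Fintype ι] [DecidableEq ι] (v : Module.Basis ι F U) : SquareClass F :=
  QuotientGroup.mk (Units.mk0 (LinearMap.BilinForm.toMatrix v β).det
    ((LinearMap.BilinForm.nondegenerate_iff_det_ne_zero v).mp hn))

/-- The discriminant of a non-degenerate form. -/
noncomputable def discriminant [Module.Finite F U] {β : LinearMap.BilinForm F U}
    (hn : β.Nondegenerate) : SquareClass F :=
  gramClass hn (Module.finBasis F U)

/-- The discriminant can be computed in any basis. -/
theorem discriminant_eq [Module.Finite F U] {β : LinearMap.BilinForm F U} (hn : β.Nondegenerate)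
    {ι : Type*} [Fintype ι] [DecidableEq ι] (v : Module.Basis ι F U) :
    discriminant hn = gramClass hn v := by
  classical
  let e : Fin (Module.finrank F U) ≃ ι := (Module.finBasis F U).indexEquiv v
  let w : Module.Basis (Fin (Module.finrank F U)) F U := v.reindex e.symm
  have h1 : (LinearMap.BilinForm.toMatrix w β).det = (LinearMap.BilinForm.toMatrix v β).det := by
    rw [← Matrix.det_submatrix_equiv_self e]
    congr 1
    ext i j
    simp [w, LinearMap.BilinForm.toMatrix_apply]
  have h2 : (LinearMap.BilinForm.toMatrix w β) =
      ((Module.finBasis F U).toMatrix w).transpose *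
        (LinearMap.BilinForm.toMatrix (Module.finBasis F U) β) *
        (Module.finBasis F U).toMatrix w :=
    (LinearMap.BilinForm.toMatrix_mul_basis_toMatrix (Module.finBasis F U) w β).symm
  have h3 : ((Module.finBasis F U).toMatrix w).det ≠ 0 := by
    have := ((Module.finBasis F U).isUnit_det w)
    rw [Module.Basis.det_apply] at this
    exact this.ne_zero
  rw [discriminant, gramClass, gramClass, QuotientGroup.eq]
  refine ⟨Units.mk0 _ h3, ?_⟩
  rw [eq_inv_mul_iff_mul_eq]
  apply Units.ext
  simp only [powMonoidHom_apply, Units.val_mul, Units.val_pow_eq_pow_val, Units.val_mk0]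
  rw [← h1, h2, Matrix.det_mul, Matrix.det_mul, Matrix.det_transpose]
  ring

end Discriminant

section Reduction

variable {F : Type*} [Field F] {U : Type*} [AddCommGroup U] [Module F U]

/-- The quotient space `N^⊥ / N`. -/
abbrev Reduced (β : LinearMap.BilinForm F U) (N : Submodule F U) : Type _ :=
  β.orthogonal N ⧸ N.submoduleOf (β.orthogonal N)

/-- The form on `N^⊥ / N` inherited from `U`: `β'([u], [v]) = β(u, v)`. -/
def reducedForm {β : LinearMap.BilinForm F U} (hs : β.IsSymm) (N : Submodule F U) :
    LinearMap.BilinForm F (Reduced β N) :=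
  (N.submoduleOf (β.orthogonal N)).liftQ
    { toFun := fun u => (N.submoduleOf (β.orthogonal N)).liftQ
        ((β u).domRestrict (β.orthogonal N)) (by
          intro v hv
          have h : β v u = 0 := u.2 v hv
          have h' : β v u = β u v := hs.eq v u
          rw [LinearMap.mem_ker, LinearMap.domRestrict_apply, ← h', h])
      map_add' := fun u u' => by ext v; simp
      map_smul' := fun c u => by ext v; simp }
    (by
      intro u hu
      rw [LinearMap.mem_ker]
      ext v
      exact v.2 u hu)

@[simp] lemma reducedForm_mk {β : LinearMap.BilinForm F U} (hs : β.IsSymm) (N : Submodule F U)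
    (u v : β.orthogonal N) :
    reducedForm hs N (Submodule.Quotient.mk u) (Submodule.Quotient.mk v) = β u v := rfl

lemma reducedForm_isSymm {β : LinearMap.BilinForm F U} (hs : β.IsSymm) (N : Submodule F U) :
    (reducedForm hs N).IsSymm where
  eq x y := by
    obtain ⟨u, rfl⟩ := Submodule.Quotient.mk_surjective _ x
    obtain ⟨v, rfl⟩ := Submodule.Quotient.mk_surjective _ y
    exact hs.eq u v

lemma reducedForm_nondegenerate [Module.Finite F U] {β : LinearMap.BilinForm F U} (hs : β.IsSymm)
    (hn : β.Nondegenerate) (N : Submodule F U) : (reducedForm hs N).Nondegenerate := by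
  have hsym := reducedForm_isSymm hs N
  have hleft : ∀ x, (∀ y, reducedForm hs N x y = 0) → x = 0 := by
    intro x hx
    obtain ⟨u, rfl⟩ := Submodule.Quotient.mk_surjective _ x
    rw [Submodule.Quotient.mk_eq_zero]
    change (u : U) ∈ N
    have hNN := LinearMap.BilinForm.orthogonal_orthogonal hn hs.isRefl N
    suffices hu : (u : U) ∈ β.orthogonal (β.orthogonal N) from hNN.le hu
    intro v hv
    have h := hx (Submodule.Quotient.mk ⟨v, hv⟩)
    rw [reducedForm_mk] at h
    exact hs.isRefl _ _ h
  exact ⟨hleft, fun y hy => hleft y fun x => hsym.isRefl _ _ (hy x)⟩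

/-- The stabilizer `O_N` of `N` in `O(U)`. -/
def stabilizer (β : LinearMap.BilinForm F U) (N : Submodule F U) :
    Subgroup (isometryGroup β) where
  carrier := {g | N.map ((g : U ≃ₗ[F] U) : U →ₗ[F] U) = N}
  mul_mem' := by
    intro g h hg hh
    change N.map (((g : U ≃ₗ[F] U) : U →ₗ[F] U) ∘ₗ ((h : U ≃ₗ[F] U) : U →ₗ[F] U)) = N
    rw [Submodule.map_comp]
    exact (congrArg _ hh).trans hg
  one_mem' := Submodule.map_id N
  inv_mem' := by
    intro g hg
    change N.map (((g : U ≃ₗ[F] U).symm) : U →ₗ[F] U) = N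
    have hg' : N.map ((g : U ≃ₗ[F] U) : U →ₗ[F] U) = N := hg
    conv_lhs => rw [← hg']
    rw [← Submodule.map_comp]
    simp

variable {β : LinearMap.BilinForm F U} {N : Submodule F U}

lemma stabilizer_apply_mem (g : stabilizer β N) {u : U} (hu : u ∈ N) :
    ((g : isometryGroup β) : U ≃ₗ[F] U) u ∈ N := by
  have : N.map (((g : isometryGroup β) : U ≃ₗ[F] U) : U →ₗ[F] U) = N := g.2
  exact this.le (Submodule.mem_map_of_mem hu)

lemma stabilizer_apply_mem_orthogonal (g : stabilizer β N) {u : U} (hu : u ∈ β.orthogonal N) :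
    ((g : isometryGroup β) : U ≃ₗ[F] U) u ∈ β.orthogonal N := by
  intro n hn
  have h := hu _ (stabilizer_apply_mem g⁻¹ hn)
  have h2 := (g : isometryGroup β).2 (((g⁻¹ : stabilizer β N) : isometryGroup β).1 n) u
  have e : ((g : isometryGroup β) : U ≃ₗ[F] U)
      (((g⁻¹ : stabilizer β N) : isometryGroup β).1 n) = n :=
    LinearEquiv.apply_symm_apply _ n
  rw [e] at h2
  exact h2.trans h

/-- The map that an element of `O_N` induces on `N^⊥ / N`. -/
def reducedMap (g : stabilizer β N) : Reduced β N →ₗ[F] Reduced β N :=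
  Submodule.mapQ _ _
    ((((g : isometryGroup β) : U ≃ₗ[F] U) : U →ₗ[F] U).restrict
      fun _ hu => stabilizer_apply_mem_orthogonal g hu)
    fun _ hu => stabilizer_apply_mem g hu

lemma reducedMap_mul (g h : stabilizer β N) :
    reducedMap (g * h) = reducedMap g ∘ₗ reducedMap h := by
  refine LinearMap.ext fun x => ?_
  obtain ⟨u, rfl⟩ := Submodule.Quotient.mk_surjective _ x
  rfl

lemma reducedMap_one : reducedMap (1 : stabilizer β N) = LinearMap.id := by
  refine LinearMap.ext fun x => ?_
  obtain ⟨u, rfl⟩ := Submodule.Quotient.mk_surjective _ x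
  rfl

/-- The action of the stabilizer `O_N` on `N^⊥ / N`, `g [u] = [g u]`, as a homomorphism
`O_N → O(N^⊥ / N)`. -/
def toReduced (hs : β.IsSymm) (N : Submodule F U) :
    stabilizer β N →* isometryGroup (reducedForm hs N) where
  toFun g := ⟨LinearEquiv.ofLinearMap (reducedMap g) (reducedMap g⁻¹)
      (by rw [← reducedMap_mul, mul_inv_cancel, reducedMap_one])
      (by rw [← reducedMap_mul, inv_mul_cancel, reducedMap_one]), by
    intro x y
    obtain ⟨u, rfl⟩ := Submodule.Quotient.mk_surjective _ x
    obtain ⟨v, rfl⟩ := Submodule.Quotient.mk_surjective _ y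
    exact (g : isometryGroup β).2 u v⟩
  map_one' := by
    apply Subtype.ext
    apply LinearEquiv.toLinearMap_injective
    exact reducedMap_one
  map_mul' g h := by
    apply Subtype.ext
    apply LinearEquiv.toLinearMap_injective
    exact reducedMap_mul g h

@[simp] lemma toReduced_mk (hs : β.IsSymm) (N : Submodule F U) (g : stabilizer β N)
    (u : β.orthogonal N) :
    (toReduced hs N g : Reduced β N ≃ₗ[F] Reduced β N) (Submodule.Quotient.mk u) =
      Submodule.Quotient.mk ⟨((g : isometryGroup β) : U ≃ₗ[F] U) u,
        stabilizer_apply_mem_orthogonal g u.2⟩ := rfl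

/-- The tensor power CSS code `C_N`: the functions on `Hom(X → U)` that are supported on
`Hom(X → N^⊥)` and constant on cosets of `Hom(X → N)`. -/
def cssCode (X : Type*) [AddCommGroup X] [Module F X] (β : LinearMap.BilinForm F U)
    (N : Submodule F U) : Submodule ℂ ((X →ₗ[F] U) → ℂ) where
  carrier := {Φ | (∀ G, Φ G ≠ 0 → ∀ x, G x ∈ β.orthogonal N) ∧
    ∀ G G' : X →ₗ[F] U, (∀ x, (G - G') x ∈ N) → Φ G = Φ G'}
  zero_mem' := ⟨fun _ h => absurd rfl h, fun _ _ _ => rfl⟩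
  add_mem' := by
    rintro Φ Ψ ⟨h1, h2⟩ ⟨h3, h4⟩
    refine ⟨fun G hG => ?_, fun G G' h => ?_⟩
    · by_cases h : Φ G = 0
      · exact h3 G fun h' => hG (by simp [h, h'])
      · exact h1 G h
    · simp [h2 G G' h, h4 G G' h]
  smul_mem' := by
    rintro c Φ ⟨h1, h2⟩
    refine ⟨fun G hG => h1 G fun h => hG (by simp [h]), fun G G' h => ?_⟩
    simp [h2 G G' h]

end Reduction

end CSSRep

/-!
The statements about `N^⊥ / N` itself are linear algebra with a linear section `s` of the projection
`N^⊥ → N^⊥ / N`, which is isometric as a map into `U`. An isometry `g'` of `N^⊥ / N` is lifted by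
letting it act on the image of `s` and fixing the orthogonal complement of that image
(`toReduced_surjective`). The discriminant comes from the Gram matrix of the basis made of a basis
of `N`, vectors dual to it, and the image under `s` of a basis of `N^⊥ / N`
(`discriminant_reduced`).

For the representations, functions on `Hom(X → N^⊥ / N)` are identified with code vectors by pulling
back to `Hom(X → N^⊥)` and extending by zero (`codeEmbedding`). Under this identification the Weyl
operators of `N^⊥ ⊗ V` become those of `(N^⊥ / N) ⊗ V` (`weyl_codeEmbedding`), and the code is the
joint fixed space of the Weyl operators of `N ⊗ V` (`mem_cssCode_iff`). Since `g ⊗ S` preserves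
`N ⊗ V` for `g ∈ O_N`, the code is invariant, and the operator that `(g, S)` induces on it
implements `i(g) ⊗ S` on Weyl operators (`codeRep_implements`). By Schur's lemma it is a multiple of
`μ_{U' ⊗ V}(i(g), S)`, and the scalar is a linear character `χ` of `O_N × Sp(V)`.

It remains to see that `χ = 1` (`codeRep_eq`). On `O_N` both sides are composition operators with
signs given by determinants, and `det g = det i(g)`: the contributions of `N` and `U / N^⊥` cancel
by duality (`det_toReduced`). The group `Sp(V)` need not be perfect, so that normalizations matter
there as well. It is generated by transvections (`mem_of_symplecticTransvection_mem`), each of which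
is conjugate to one along a vector of `X` (`character_eq_one`); these act by multiplication with
explicit phases, which agree on the code (`codeRep_transvection`).
-/

namespace CSSRep

open scoped TensorProduct

/-! ### Symplectic transvections -/

section Transvections

variable {F : Type*} [Field F] {V : Type*} [AddCommGroup V] [Module F V]
  {ω : V →ₗ[F] V →ₗ[F] F}

/-- The symplectic transvection `w ↦ w + a ω(w, v) v` of an alternating form `ω`. -/
def symplecticTransvection (hω : ω.IsAlt) (a : F) (v : V) : isometryGroup ω :=
  ⟨LinearEquiv.ofLinearMap (LinearMap.id + a • (ω.flip v).smulRight v)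
      (LinearMap.id + (-a) • (ω.flip v).smulRight v)
      (by ext w; simp [hω.self_eq_zero])
      (by ext w; simp [hω.self_eq_zero]), by
    intro x y
    have h := hω.neg v y
    simp [hω.self_eq_zero, ← h]
    ring⟩

lemma symplecticTransvection_apply (hω : ω.IsAlt) (a : F) (v w : V) :
    (symplecticTransvection hω a v : V ≃ₗ[F] V) w = w + (a * ω w v) • v := by
  simp [symplecticTransvection, mul_smul]

lemma exists_symplecticTransvection_apply_eq (hω : ω.IsAlt) {v w : V} (h : ω v w ≠ 0) :
    ∃ a, (symplecticTransvection hω a (v - w) : V ≃ₗ[F] V) v = w := by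
  refine ⟨(ω v w)⁻¹, ?_⟩
  rw [symplecticTransvection_apply]
  simp [hω.self_eq_zero, h]

lemma conj_symplecticTransvection (hω : ω.IsAlt) (g : isometryGroup ω) (a : F) (v : V) :
    g * symplecticTransvection hω a v * g⁻¹ =
      symplecticTransvection hω a ((g : V ≃ₗ[F] V) v) := by
  rw [mul_inv_eq_iff_eq_mul]
  refine Subtype.ext (LinearEquiv.ext fun w => ?_)
  change (g : V ≃ₗ[F] V) ((symplecticTransvection hω a v : V ≃ₗ[F] V) w) =
    (symplecticTransvection hω a ((g : V ≃ₗ[F] V) v) : V ≃ₗ[F] V) ((g : V ≃ₗ[F] V) w)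
  rw [symplecticTransvection_apply, symplecticTransvection_apply, g.2]
  simp

/-- The fixed space of an isometry. -/
def fixedSpace (g : isometryGroup ω) : Submodule F V :=
  LinearMap.eqLocus ((g : V ≃ₗ[F] V) : V →ₗ[F] V) LinearMap.id

lemma mem_fixedSpace {g : isometryGroup ω} {v : V} :
    v ∈ fixedSpace g ↔ (g : V ≃ₗ[F] V) v = v := Iff.rfl

/-- The displacement `g v - v` is orthogonal to the fixed space of `g`, so transvections along it
preserve that space pointwise. -/
lemma fixedSpace_le_mul (hω : ω.IsAlt) (g : isometryGroup ω) (a : F) (v : V) :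
    fixedSpace g ≤
      fixedSpace (symplecticTransvection hω a (v - (g : V ≃ₗ[F] V) v) * g) := by
  intro w hw
  rw [mem_fixedSpace] at hw ⊢
  change (symplecticTransvection hω a _ : V ≃ₗ[F] V) ((g : V ≃ₗ[F] V) w) = w
  have h : ω w ((g : V ≃ₗ[F] V) v) = ω w v := by
    have := g.2 w v
    rwa [hw] at this
  rw [hw, symplecticTransvection_apply]
  simp [h]

/-- The symplectic group of a non-degenerate alternating form is generated by transvections. The
induction enlarges the fixed space: if `ω(v, g v) ≠ 0`, a transvection brings `g v` back to `v`
while keeping the fixed space; if there is no such `v`, composing with a transvection along a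
displacement vector creates one. -/
theorem mem_of_symplecticTransvection_mem [Module.Finite F V] (hω : ω.IsAlt)
    (hn : ∀ v, (∀ w, ω w v = 0) → v = 0) (H : Subgroup (isometryGroup ω))
    (hH : ∀ a v, symplecticTransvection hω a v ∈ H) (g : isometryGroup ω) : g ∈ H := by
  have step : ∀ n, (∀ g : isometryGroup ω,
      Module.finrank F V < Module.finrank F (fixedSpace g) + n → g ∈ H) →
      ∀ g : isometryGroup ω, Module.finrank F V < Module.finrank F (fixedSpace g) + (n + 1) →
        (∃ v, ω v ((g : V ≃ₗ[F] V) v) ≠ 0) → g ∈ H := by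
    rintro n ih g hg ⟨v, hv⟩
    have hv' : ω ((g : V ≃ₗ[F] V) v) v ≠ 0 := by
      rw [← hω.neg]; exact neg_ne_zero.mpr hv
    obtain ⟨a, ha⟩ := exists_symplecticTransvection_apply_eq hω hv'
    have e : symplecticTransvection hω a ((g : V ≃ₗ[F] V) v - v) =
        symplecticTransvection hω a (v - (g : V ≃ₗ[F] V) v) := by
      refine Subtype.ext (LinearEquiv.ext fun w => ?_)
      rw [symplecticTransvection_apply, symplecticTransvection_apply,
        ← neg_sub v ((g : V ≃ₗ[F] V) v), map_neg, mul_neg, neg_smul_neg]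
    rw [e] at ha
    refine (Subgroup.mul_mem_cancel_left H (hH a (v - (g : V ≃ₗ[F] V) v))).mp (ih _ ?_)
    have hlt : fixedSpace g <
        fixedSpace (symplecticTransvection hω a (v - (g : V ≃ₗ[F] V) v) * g) := by
      refine lt_of_le_of_ne (fixedSpace_le_mul hω g a v) fun h => ?_
      have hm : v ∈ fixedSpace g := h ▸ (mem_fixedSpace.mpr ha)
      rw [mem_fixedSpace] at hm
      rw [hm, hω.self_eq_zero] at hv
      exact hv rfl
    have := Submodule.finrank_lt_finrank_of_lt hlt
    omega
  suffices h : ∀ n, ∀ g : isometryGroup ω,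
      Module.finrank F V < Module.finrank F (fixedSpace g) + n → g ∈ H from
    h (Module.finrank F V + 1) g (by omega)
  intro n
  induction n with
  | zero => intro g hg; exact absurd (Submodule.finrank_le (fixedSpace g)) (by omega)
  | succ n ih =>
    intro g hg
    by_cases hc : ∃ v, ω v ((g : V ≃ₗ[F] V) v) ≠ 0
    · exact step n ih g hg hc
    push Not at hc
    by_cases h1 : ∀ v, (g : V ≃ₗ[F] V) v = v
    · have : g = 1 := Subtype.ext (LinearEquiv.ext h1)
      exact this ▸ H.one_mem
    push Not at h1
    obtain ⟨x, hx⟩ := h1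
    set d : V := x - (g : V ≃ₗ[F] V) x with hd
    have hd0 : d ≠ 0 := fun h => hx (sub_eq_zero.mp h).symm
    refine (Subgroup.mul_mem_cancel_left H (hH 1 d)).mp (step n ih _ ?_ ?_)
    · have : Module.finrank F (fixedSpace g) ≤
          Module.finrank F (fixedSpace (symplecticTransvection hω 1 d * g)) :=
        Submodule.finrank_mono (fixedSpace_le_mul hω g 1 x)
      omega
    -- a vector space is not the union of the two hyperplanes `d^⊥` and `g⁻¹ (d^⊥)`
    · obtain ⟨v, hv1, hv2⟩ : ∃ v, ω v d ≠ 0 ∧ ω ((g : V ≃ₗ[F] V) v) d ≠ 0 := by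
        by_contra hcon
        push Not at hcon
        obtain ⟨u, hu⟩ : ∃ u, ω u d ≠ 0 := by
          by_contra h; push Not at h; exact hd0 (hn d h)
        obtain ⟨w, hw⟩ : ∃ w, ω ((g : V ≃ₗ[F] V) w) d ≠ 0 :=
          ⟨(g : V ≃ₗ[F] V).symm u, by simpa using hu⟩
        have hw' : ω w d = 0 := by by_contra h; exact hw (hcon w h)
        have := hcon (u + w) (by simpa [hw'] using hu)
        simp [hcon u hu] at this
        exact hw this
      refine ⟨v, ?_⟩
      change ω v ((symplecticTransvection hω 1 d : V ≃ₗ[F] V) ((g : V ≃ₗ[F] V) v)) ≠ 0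
      rw [symplecticTransvection_apply]
      simp [hc v, hv1, hv2]

end Transvections

section CharactersOfSp

variable {F : Type*} [Field F] {X : Type*} [AddCommGroup X] [Module F X]

lemma symplecticForm_isAlt {P Q : Type*} [AddCommGroup P] [Module F P] [AddCommGroup Q]
    [Module F Q] (b : P →ₗ[F] Q →ₗ[F] F) : (symplecticForm b).IsAlt :=
  symplecticForm_self b

/-- Every transvection of `X ⊕ X*` is conjugate to one along a vector of `X`, so that a linear
character of the symplectic group is determined by its values on those. -/
theorem character_eq_one [Module.Finite F X] (χ : Sp (Module.Dual.eval F X) →* ℂ)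
    (hχ : ∀ (a : F) (z : X), χ (symplecticTransvection (symplecticForm_isAlt _) a (z, 0)) = 1)
    (S : Sp (Module.Dual.eval F X)) : χ S = 1 := by
  have hω := symplecticForm_isAlt (Module.Dual.eval F X)
  suffices h : ∀ a v, symplecticTransvection hω a v ∈ χ.ker from
    MonoidHom.mem_ker.mp (mem_of_symplecticTransvection_mem hω (fun v hv =>
      symplecticForm_injective (b := Module.Dual.eval F X)
        (LinearMap.ext fun w => by simpa using hv w)) _ h S)
  rintro a ⟨x, y⟩
  rw [MonoidHom.mem_ker]
  by_cases hy : y = 0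
  · subst hy; exact hχ a x
  obtain ⟨z, hz⟩ : ∃ z, y z ≠ 0 := by
    by_contra h; push Not at h; exact hy (LinearMap.ext h)
  obtain ⟨c, hc⟩ := exists_symplecticTransvection_apply_eq hω (v := (x, y)) (w := (z, 0))
    (by simpa [symplecticForm_apply] using hz)
  set g := symplecticTransvection hω c ((x, y) - (z, 0))
  have h := conj_symplecticTransvection hω g a (x, y)
  rw [hc] at h
  have h' := hχ a z
  rw [← h, map_mul, map_mul, mul_right_comm, ← map_mul, mul_inv_cancel, map_one, one_mul] at h'
  exact h'

end CharactersOfSp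

/-! ### The quadratic space `N^⊥ / N` -/

section ReducedSection

variable {F : Type*} [Field F] {U : Type*} [AddCommGroup U] [Module F U]
  {β : LinearMap.BilinForm F U} {N : Submodule F U}

variable (β N) in
/-- A linear section of the projection `N^⊥ → N^⊥ / N`. -/
noncomputable def reducedSection : Reduced β N →ₗ[F] β.orthogonal N :=
  ((N.submoduleOf (β.orthogonal N)).mkQ.exists_rightInverse_of_surjective
    (Submodule.range_mkQ _)).choose

@[simp] lemma mk_reducedSection (a : Reduced β N) :
    Submodule.Quotient.mk (reducedSection β N a) = a :=
  LinearMap.congr_fun ((N.submoduleOf (β.orthogonal N)).mkQ.exists_rightInverse_of_surjective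
    (Submodule.range_mkQ _)).choose_spec a

lemma form_reducedSection (hs : β.IsSymm) (a c : Reduced β N) :
    β (reducedSection β N a) (reducedSection β N c) = reducedForm hs N a c := by
  rw [← reducedForm_mk hs, mk_reducedSection, mk_reducedSection]

end ReducedSection

section ReducedSpace

variable {F : Type*} [Field F] {U : Type*} [AddCommGroup U] [Module F U] [Module.Finite F U]
  {β : LinearMap.BilinForm F U} {N : Submodule F U}

theorem finrank_reduced (hn : β.Nondegenerate) (hN : N ≤ β.orthogonal N) :
    (Module.finrank F (Reduced β N) : ℤ) = Module.finrank F U - 2 * Module.finrank F N := by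
  have h1 := LinearMap.BilinForm.finrank_orthogonal hn N
  have h2 := Submodule.finrank_quotient_add_finrank (N.submoduleOf (β.orthogonal N))
  have h3 := (Submodule.submoduleOfEquivOfLe hN).finrank_eq
  have h4 := Submodule.finrank_le N
  have h5 : Module.finrank F (Reduced β N) + Module.finrank F (N.submoduleOf (β.orthogonal N)) =
    Module.finrank F (β.orthogonal N) := h2
  omega

/-- An isometry of `N^⊥ / N` is lifted by letting it act on the image of a section, which is a
non-degenerate subspace of `U`, and fixing the orthogonal complement of that image. -/
theorem toReduced_surjective (hs : β.IsSymm) (hn : β.Nondegenerate) :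
    Function.Surjective (toReduced hs N) := by
  have hn' := reducedForm_nondegenerate hs hn N
  set β' := reducedForm hs N with hβ'
  let s : Reduced β N →ₗ[F] U := (β.orthogonal N).subtype ∘ₗ reducedSection β N
  have hss : ∀ a c, β (s a) (s c) = β' a c := form_reducedSection hs
  -- the adjoint of the section
  obtain ⟨t, ht⟩ : ∃ t : U →ₗ[F] Reduced β N, ∀ u a, β' (t u) a = β u (s a) := by
    refine ⟨(LinearMap.BilinForm.toDual β' hn').symm.toLinearMap ∘ₗ s.dualMap ∘ₗ β, fun u a => ?_⟩
    rw [← LinearMap.BilinForm.toDual_def hn']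
    simp
  have hinj : ∀ a c, (∀ d, β' a d = β' c d) → a = c := by
    intro a c h
    rw [← sub_eq_zero]
    exact hn'.1 _ fun d => by rw [map_sub, LinearMap.sub_apply, h, sub_self]
  have hts : ∀ a, t (s a) = a := fun a => hinj _ _ fun d => by rw [ht, hss]
  have hts' : ∀ u a, β (s a) u = β' a (t u) := fun u a => by
    rw [hs.eq (s a) u, ← ht]; exact (reducedForm_isSymm hs N).eq _ _
  have htN : ∀ n ∈ N, t n = 0 := fun n hnN => hinj _ _ fun d => by
    rw [ht, map_zero, LinearMap.zero_apply]
    exact (reducedSection β N d).2 n hnN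
  let L : (Reduced β N ≃ₗ[F] Reduced β N) → U →ₗ[F] U := fun g =>
    LinearMap.id + s ∘ₗ (g.toLinearMap - LinearMap.id) ∘ₗ t
  have hL : ∀ g u, L g u = u + s (g (t u) - t u) := fun _ _ => rfl
  have htL : ∀ g u, t (L g u) = g (t u) := fun g u => by
    rw [hL, map_add, hts, add_sub_cancel]
  have hLL : ∀ g u, L g.symm (L g u) = u := fun g u => by
    rw [hL, htL, hL, LinearEquiv.symm_apply_apply, add_assoc, ← map_add]
    simp
  intro g
  let G : U ≃ₗ[F] U := LinearEquiv.ofLinearMap (L (g : Reduced β N ≃ₗ[F] Reduced β N))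
    (L (g : Reduced β N ≃ₗ[F] Reduced β N).symm)
    (LinearMap.ext fun u => hLL (g : Reduced β N ≃ₗ[F] Reduced β N).symm u)
    (LinearMap.ext fun u => hLL _ u)
  have hG : ∀ u, G u = u + s ((g : Reduced β N ≃ₗ[F] Reduced β N) (t u) - t u) := fun _ => rfl
  have hGm : G ∈ isometryGroup β := by
    intro u w
    have h := g.2 (t u) (t w)
    rw [hG, hG]
    simp only [map_add, map_sub, LinearMap.add_apply, LinearMap.sub_apply, hss, hts', ← ht]
    simp only [← hβ'] at h
    rw [h]
    ring
  have hGN : ∀ n ∈ N, G n = n := fun n hnN => by rw [hG, htN n hnN]; simp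
  have hGs : (⟨G, hGm⟩ : isometryGroup β) ∈ stabilizer β N := by
    change N.map (G : U →ₗ[F] U) = N
    refine le_antisymm ?_ fun n hnN => ⟨n, hnN, hGN n hnN⟩
    rintro _ ⟨n, hnN, rfl⟩
    exact (hGN n hnN).symm ▸ hnN
  refine ⟨⟨⟨G, hGm⟩, hGs⟩, Subtype.ext (LinearEquiv.ext fun a => ?_)⟩
  conv_lhs => rw [← mk_reducedSection a]
  rw [toReduced_mk, ← mk_reducedSection ((g : Reduced β N ≃ₗ[F] Reduced β N) a)]
  congr 1
  apply Subtype.ext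
  change G (s a) = s _
  rw [hG, hts, map_sub, add_sub_cancel]

/-- The pairing of `U / N^⊥` with `N`, as an isomorphism onto the dual. -/
noncomputable def quotientOrthogonalEquiv (hs : β.IsSymm) (hn : β.Nondegenerate)
    (N : Submodule F U) : (U ⧸ β.orthogonal N) ≃ₗ[F] Module.Dual F N :=
  LinearEquiv.ofInjectiveOfFinrankEq
    ((β.orthogonal N).liftQ (N.subtype.dualMap ∘ₗ β) fun u hu => by
      ext n; exact (hs.eq _ _).trans (hu n n.2))
    (by
      rw [injective_iff_map_eq_zero]
      intro x hx
      obtain ⟨u, rfl⟩ := Submodule.Quotient.mk_surjective _ x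
      rw [Submodule.Quotient.mk_eq_zero]
      intro n hnN
      exact (hs.eq _ _).trans (LinearMap.congr_fun hx ⟨n, hnN⟩))
    (by
      have h1 := LinearMap.BilinForm.finrank_orthogonal hn N
      have h2 := Submodule.finrank_quotient_add_finrank (β.orthogonal N)
      have h3 := Submodule.finrank_le N
      rw [Subspace.dual_finrank_eq]
      omega)

lemma quotientOrthogonalEquiv_mk (hs : β.IsSymm) (hn : β.Nondegenerate) (u : U) (n : N) :
    quotientOrthogonalEquiv hs hn N (Submodule.Quotient.mk u) n = β u n := rfl

/-- In the filtration `N ≤ N^⊥ ≤ U`, the determinants on `N` and on `U / N^⊥` are inverse to each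
other by duality, so that only the determinant on `N^⊥ / N` remains. -/
theorem det_toReduced (hs : β.IsSymm) (hn : β.Nondegenerate) (hN : N ≤ β.orthogonal N)
    (g : stabilizer β N) :
    LinearMap.det (((g : isometryGroup β) : U ≃ₗ[F] U) : U →ₗ[F] U) =
      LinearMap.det ((toReduced hs N g : Reduced β N ≃ₗ[F] Reduced β N) :
        Reduced β N →ₗ[F] Reduced β N) := by
  let gl : U →ₗ[F] U := ((g : isometryGroup β) : U ≃ₗ[F] U)
  let gi : U →ₗ[F] U := (((g⁻¹ : stabilizer β N) : isometryGroup β) : U ≃ₗ[F] U)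
  have hgi : ∀ u, gl (gi u) = u := fun u => LinearEquiv.apply_symm_apply _ u
  have h1 : β.orthogonal N ≤ (β.orthogonal N).comap gl :=
    fun _ hu => stabilizer_apply_mem_orthogonal g hu
  have h2 : N ≤ N.comap gl := fun _ hu => stabilizer_apply_mem g hu
  have h2' : N ≤ N.comap gi := fun _ hu => stabilizer_apply_mem g⁻¹ hu
  have h3 : N.submoduleOf (β.orthogonal N) ≤
      (N.submoduleOf (β.orthogonal N)).comap (gl.restrict h1) :=
    fun _ hu => stabilizer_apply_mem g hu
  have e1 := LinearMap.det_eq_det_mul_det (β.orthogonal N) gl h1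
  have e2 := LinearMap.det_eq_det_mul_det (N.submoduleOf (β.orthogonal N)) (gl.restrict h1) h3
  have e3 : LinearMap.det ((gl.restrict h1).restrict h3) = LinearMap.det (gl.restrict h2) := by
    rw [← LinearMap.det_conj _ (Submodule.submoduleOfEquivOfLe hN)]
    rfl
  have e4 : LinearMap.det ((β.orthogonal N).mapQ _ gl h1) = LinearMap.det (gi.restrict h2') := by
    rw [← LinearMap.det_dualMap (gi.restrict h2'),
      ← LinearMap.det_conj _ (quotientOrthogonalEquiv hs hn N)]
    congr 1
    refine LinearMap.ext fun φ => ?_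
    obtain ⟨x, rfl⟩ := (quotientOrthogonalEquiv hs hn N).surjective φ
    obtain ⟨u, rfl⟩ := Submodule.Quotient.mk_surjective _ x
    ext n
    have h := (g : isometryGroup β).2 u (gi n)
    have h' : ((g : isometryGroup β) : U ≃ₗ[F] U) (gi n) = n := hgi n
    rw [h'] at h
    simp only [LinearMap.comp_apply, LinearEquiv.coe_coe, LinearEquiv.symm_apply_apply]
    exact h
  have e5 : LinearMap.det (gl.restrict h2) * LinearMap.det (gi.restrict h2') = 1 := by
    rw [← map_mul, ← LinearMap.det_id (A := F) (M := N)]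
    congr 1
    ext n
    exact hgi n
  have e6 : LinearMap.det ((toReduced hs N g : Reduced β N ≃ₗ[F] Reduced β N) :
      Reduced β N →ₗ[F] Reduced β N) = LinearMap.det
        ((N.submoduleOf (β.orthogonal N)).mapQ _ (gl.restrict h1) h3) := rfl
  change LinearMap.det gl = _
  rw [e6, e1, e2, e3, e4]
  linear_combination LinearMap.det
    ((N.submoduleOf (β.orthogonal N)).mapQ _ (gl.restrict h1) h3) * e5

end ReducedSpace

/-! ### The discriminant of `N^⊥ / N` -/

section ReducedDiscriminant

lemma det_fromBlocks_zero_one_one {R ι : Type*} [CommRing R] [Fintype ι] [DecidableEq ι]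
    (D : Matrix ι ι R) : (Matrix.fromBlocks 0 (1 : Matrix ι ι R) (1 : Matrix ι ι R) D).det =
      (-1) ^ Fintype.card ι := by
  -- adding the second block row to the first gives a matrix with invertible upper left block
  have h : Matrix.fromBlocks 0 (1 : Matrix ι ι R) (1 : Matrix ι ι R) D =
      Matrix.fromBlocks 1 (-1) 0 1 * Matrix.fromBlocks 1 (1 + D) 1 D := by
    simp [Matrix.fromBlocks_multiply]
  rw [h, Matrix.det_mul, Matrix.det_fromBlocks_zero₂₁, Matrix.det_fromBlocks_one₁₁]
  simp [Matrix.det_neg]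

variable {F : Type*} [Field F] {U : Type*} [AddCommGroup U] [Module F U]
  {β : LinearMap.BilinForm F U}

lemma linearIndependent_of_det_gram_ne_zero {ι : Type*} [Fintype ι] [DecidableEq ι] (v : ι → U)
    (h : (Matrix.of fun i j => β (v i) (v j)).det ≠ 0) : LinearIndependent F v := by
  rw [Fintype.linearIndependent_iff]
  intro c hc
  refine congrFun (Matrix.eq_zero_of_vecMul_eq_zero h (v := c) (funext fun j => ?_))
  have := LinearMap.congr_fun (congrArg β hc) (v j)
  simpa [Matrix.vecMul, dotProduct] using this

/-- A basis of `N`, vectors dual to it, and a lift of a basis of `N^⊥ / N` form a basis of `U`.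
Its Gram matrix has the Gram matrix of `N^⊥ / N` as one block, and the Schur complement of that
block has determinant `(-1)^(dim N)`. -/
theorem discriminant_reduced [Module.Finite F U] (hs : β.IsSymm) (hn : β.Nondegenerate)
    {N : Submodule F U} (hN : N ≤ β.orthogonal N) (hn' : (reducedForm hs N).Nondegenerate) :
    discriminant hn' = QuotientGroup.mk ((-1) ^ Module.finrank F N) * discriminant hn := by
  classical
  let n := Module.finBasis F N
  let e := Module.finBasis F (Reduced β N)
  have hm : ∀ i, ∃ m : U, ∀ j, β m (n j) = if i = j then 1 else 0 := by
    intro i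
    obtain ⟨x, hx⟩ := (quotientOrthogonalEquiv hs hn N).surjective (n.coord i)
    obtain ⟨m, rfl⟩ := Submodule.Quotient.mk_surjective _ x
    refine ⟨m, fun j => ?_⟩
    rw [← quotientOrthogonalEquiv_mk hs hn, hx]
    simp [Finsupp.single_apply, eq_comm]
  choose m hm using hm
  let v := Sum.elim (Sum.elim (fun i => (n i : U)) m) fun j => (reducedSection β N (e j) : U)
  let G' := LinearMap.BilinForm.toMatrix e (reducedForm hs N)
  have hdet' : G'.det ≠ 0 := (LinearMap.BilinForm.nondegenerate_iff_det_ne_zero e).mp hn'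
  have hgram : (Matrix.of fun i j => β (v i) (v j)) = Matrix.fromBlocks
      (Matrix.fromBlocks 0 1 1 (Matrix.of fun i j => β (m i) (m j)))
      (Matrix.fromRows 0 (Matrix.of fun i j => β (m i) (reducedSection β N (e j))))
      (Matrix.fromCols 0 (Matrix.of fun i j => β (reducedSection β N (e i)) (m j))) G' := by
    have hsymm : ∀ x y, β x y = β y x := hs.eq
    ext i j
    rcases i with (i | i) | i <;> rcases j with (j | j) | j
    · exact hN (n j).2 (n i) (n i).2
    · simp [v, hsymm _ (m j), hm, Matrix.one_apply, eq_comm]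
    · exact (reducedSection β N (e j)).2 (n i) (n i).2
    · simp [v, hm, Matrix.one_apply]
    · rfl
    · rfl
    · exact (hsymm _ _).trans ((reducedSection β N (e i)).2 (n j) (n j).2)
    · rfl
    · simp [v, G', form_reducedSection hs, LinearMap.BilinForm.toMatrix_apply]
  have hdet : (Matrix.of fun i j => β (v i) (v j)).det =
      G'.det * (-1) ^ Module.finrank F N := by
    have := Matrix.invertibleOfIsUnitDet G' (isUnit_iff_ne_zero.mpr hdet')
    rw [hgram, Matrix.det_fromBlocks₂₂, Matrix.fromRows_mul, Matrix.fromRows_mul_fromCols]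
    simp only [Matrix.zero_mul, Matrix.mul_zero]
    rw [sub_eq_add_neg, Matrix.fromBlocks_neg, Matrix.fromBlocks_add]
    simp only [neg_zero, add_zero]
    rw [det_fromBlocks_zero_one_one, Fintype.card_fin]
  have hdet0 : (Matrix.of fun i j => β (v i) (v j)).det ≠ 0 := by
    rw [hdet]; exact mul_ne_zero hdet' (pow_ne_zero _ (neg_ne_zero.mpr one_ne_zero))
  have hcard : Fintype.card ((Fin (Module.finrank F N) ⊕ Fin (Module.finrank F N)) ⊕
      Fin (Module.finrank F (Reduced β N))) = Module.finrank F U := by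
    have := finrank_reduced hn hN
    simp only [Fintype.card_sum, Fintype.card_fin]
    omega
  have hli := linearIndependent_of_det_gram_ne_zero v hdet0
  let b := Module.Basis.mk hli (hli.span_eq_top_of_card_eq_finrank' hcard).ge
  have hb : LinearMap.BilinForm.toMatrix b β = Matrix.of fun i j => β (v i) (v j) := by
    ext i j; simp [b, LinearMap.BilinForm.toMatrix_apply]
  rw [discriminant_eq hn b, discriminant, gramClass, gramClass, ← QuotientGroup.mk_mul]
  congr 1
  ext
  simp only [Units.val_mul, Units.val_mk0, Units.val_pow_eq_pow_val, Units.val_neg, Units.val_one]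
  rw [hb, hdet, mul_comm, mul_assoc, ← mul_pow, neg_mul_neg, one_mul, one_pow, mul_one]

end ReducedDiscriminant

/-! ### Functions on `Hom(X → N^⊥ / N)` as code vectors -/

section Code

variable {F : Type*} [Field F] {X U : Type*} [AddCommGroup X] [Module F X] [AddCommGroup U]
  [Module F U] {β : LinearMap.BilinForm F U} {N : Submodule F U}

/-- The map `Hom(X → N^⊥) → Hom(X → N^⊥ / N)`. -/
def reduceHom (G : X →ₗ[F] U) (h : ∀ x, G x ∈ β.orthogonal N) : X →ₗ[F] Reduced β N :=
  (N.submoduleOf (β.orthogonal N)).mkQ ∘ₗ G.codRestrict _ h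

lemma reduceHom_apply (G : X →ₗ[F] U) (h : ∀ x, G x ∈ β.orthogonal N) (x : X) :
    reduceHom G h x = Submodule.Quotient.mk ⟨G x, h x⟩ := rfl

/-- A right inverse of `reduceHom`. -/
noncomputable def liftHom (H : X →ₗ[F] Reduced β N) : X →ₗ[F] U :=
  (β.orthogonal N).subtype ∘ₗ reducedSection β N ∘ₗ H

lemma liftHom_mem (H : X →ₗ[F] Reduced β N) (x : X) : liftHom H x ∈ β.orthogonal N :=
  (reducedSection β N (H x)).2

lemma reduceHom_liftHom (H : X →ₗ[F] Reduced β N) :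
    reduceHom (liftHom H) (liftHom_mem H) = H :=
  LinearMap.ext fun x => mk_reducedSection (H x)

open Classical in
variable (X β N) in
/-- The embedding of `L²(Hom(X → N^⊥ / N))` into `L²(Hom(X → U))` that pulls a function back to
`Hom(X → N^⊥)` and extends it by zero. -/
noncomputable def codeEmbedding : ((X →ₗ[F] Reduced β N) → ℂ) →ₗ[ℂ] ((X →ₗ[F] U) → ℂ) where
  toFun f G := if h : ∀ x, G x ∈ β.orthogonal N then f (reduceHom G h) else 0
  map_add' f f' := by ext G; dsimp only [Pi.add_apply]; split_ifs <;> simp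
  map_smul' c f := by ext G; dsimp only [Pi.smul_apply]; split_ifs <;> simp

lemma codeEmbedding_of_mem (f : (X →ₗ[F] Reduced β N) → ℂ) {G : X →ₗ[F] U}
    (h : ∀ x, G x ∈ β.orthogonal N) : codeEmbedding X β N f G = f (reduceHom G h) := dif_pos h

lemma codeEmbedding_of_not_mem (f : (X →ₗ[F] Reduced β N) → ℂ) {G : X →ₗ[F] U}
    (h : ¬ ∀ x, G x ∈ β.orthogonal N) : codeEmbedding X β N f G = 0 := dif_neg h

lemma codeEmbedding_injective : Function.Injective (codeEmbedding X β N) := by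
  intro f f' h
  ext H
  have := congrFun h (liftHom H)
  rwa [codeEmbedding_of_mem f (liftHom_mem H), codeEmbedding_of_mem f' (liftHom_mem H),
    reduceHom_liftHom] at this

lemma range_codeEmbedding (hN : N ≤ β.orthogonal N) :
    LinearMap.range (codeEmbedding X β N) = cssCode X β N := by
  apply le_antisymm
  · rintro _ ⟨f, rfl⟩
    refine ⟨fun G hG => by_contra fun h => hG (codeEmbedding_of_not_mem f h), fun G G' h => ?_⟩
    have hiff : (∀ x, G x ∈ β.orthogonal N) ↔ ∀ x, G' x ∈ β.orthogonal N :=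
      forall_congr' fun x => (Submodule.sub_mem_iff_left _ (hN (h x))).symm.trans (by simp)
    by_cases hG : ∀ x, G x ∈ β.orthogonal N
    · rw [codeEmbedding_of_mem f hG, codeEmbedding_of_mem f (hiff.mp hG)]
      congr 1
      ext x
      exact (Submodule.Quotient.eq _).mpr (h x)
    · rw [codeEmbedding_of_not_mem f hG, codeEmbedding_of_not_mem f (hiff.not.mp hG)]
  · rintro Φ ⟨h1, h2⟩
    refine ⟨fun H => Φ (liftHom H), funext fun G => ?_⟩
    by_cases hG : ∀ x, G x ∈ β.orthogonal N
    · rw [codeEmbedding_of_mem _ hG]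
      refine h2 _ _ fun x => ?_
      have := mk_reducedSection (reduceHom G hG x)
      rw [reduceHom_apply, Submodule.Quotient.eq] at this
      exact this
    · rw [codeEmbedding_of_not_mem _ hG]
      by_contra h
      exact hG (h1 G fun h' => h h'.symm)

variable (X) in
/-- The identification of `L²(Hom(X → N^⊥ / N))` with the code. -/
noncomputable def codeEquiv (hN : N ≤ β.orthogonal N) :
    ((X →ₗ[F] Reduced β N) → ℂ) ≃ₗ[ℂ] cssCode X β N :=
  (LinearEquiv.ofInjective _ codeEmbedding_injective).trans
    (LinearEquiv.ofEq _ _ (range_codeEmbedding hN))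

lemma coe_codeEquiv (hN : N ≤ β.orthogonal N) (f : (X →ₗ[F] Reduced β N) → ℂ) :
    (codeEquiv X hN f : (X →ₗ[F] U) → ℂ) = codeEmbedding X β N f := rfl

end Code

section CodeWeyl

variable {F : Type*} [Field F] {X U : Type*} [AddCommGroup X] [Module F X] [Module.Finite F X]
  [AddCommGroup U] [Module F U] [Module.Finite F U] {β : LinearMap.BilinForm F U}
  {N : Submodule F U} (ψ : AddChar F ℂ)

lemma weyl_tensor_apply (u : U) (v : X × Module.Dual F X) (f : (X →ₗ[F] U) → ℂ)
    (G : X →ₗ[F] U) :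
    weyl ψ (tensorPairing X β) (tensorEquiv F X U (u ⊗ₜ v)) f G =
      ψ (β u (G v.1) - 2⁻¹ * (v.2 v.1 * β u u)) * f (G - v.2.smulRight u) := by
  obtain ⟨x, y⟩ := v
  simp [weyl_apply, tensorEquiv_tmul]

/-- The Weyl operators of `N^⊥ ⊗ V` act on the code through those of `(N^⊥ / N) ⊗ V`. -/
lemma weyl_codeEmbedding (hs : β.IsSymm) (u : β.orthogonal N) (v : X × Module.Dual F X)
    (f : (X →ₗ[F] Reduced β N) → ℂ) :
    weyl ψ (tensorPairing X β) (tensorEquiv F X U ((u : U) ⊗ₜ v)) (codeEmbedding X β N f) =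
      codeEmbedding X β N (weyl ψ (tensorPairing X (reducedForm hs N))
        (tensorEquiv F X (Reduced β N) (Submodule.Quotient.mk u ⊗ₜ v)) f) := by
  ext G
  rw [weyl_tensor_apply]
  have hu : ∀ x, v.2.smulRight (u : U) x ∈ β.orthogonal N := fun x =>
    Submodule.smul_mem _ _ u.2
  have hiff : (∀ x, G x ∈ β.orthogonal N) ↔
      ∀ x, (G - v.2.smulRight (u : U)) x ∈ β.orthogonal N :=
    forall_congr' fun x => (Submodule.sub_mem_iff_left _ (hu x)).symm
  by_cases hG : ∀ x, G x ∈ β.orthogonal N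
  · rw [codeEmbedding_of_mem _ hG, codeEmbedding_of_mem _ (hiff.mp hG), weyl_tensor_apply]
    rfl
  · rw [codeEmbedding_of_not_mem _ hG, codeEmbedding_of_not_mem _ (hiff.not.mp hG), mul_zero]

variable {ψ}

/-- The code is the joint fixed space of the Weyl operators of `N ⊗ V`. -/
lemma mem_cssCode_iff (hs : β.IsSymm) (hψ : ψ ≠ 1) (hN : N ≤ β.orthogonal N)
    (Φ : (X →ₗ[F] U) → ℂ) : Φ ∈ cssCode X β N ↔ ∀ n ∈ N, ∀ v : X × Module.Dual F X,
      weyl ψ (tensorPairing X β) (tensorEquiv F X U (n ⊗ₜ v)) Φ = Φ := by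
  constructor
  · intro h n hnN v
    obtain ⟨f, rfl⟩ := (range_codeEmbedding (X := X) hN).ge h
    have h0 : (Submodule.Quotient.mk ⟨n, hN hnN⟩ : Reduced β N) = 0 :=
      (Submodule.Quotient.mk_eq_zero _).mpr hnN
    rw [weyl_codeEmbedding ψ hs ⟨n, hN hnN⟩, h0, TensorProduct.zero_tmul, map_zero, weyl_zero]
    rfl
  · intro h
    refine ⟨fun G hG x n hnN => ?_, fun G G' hGG => ?_⟩
    · -- a nonzero value `β(n, G x)` could be scaled to one on which `ψ` is nontrivial
      by_contra hx
      have hx' : β n (G x) ≠ 0 := hx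
      apply hψ
      ext a
      have h1 := congrFun (h ((a / β n (G x)) • n) (N.smul_mem _ hnN) (x, 0)) G
      rw [weyl_tensor_apply] at h1
      have h0 : G - (0 : Module.Dual F X).smulRight ((a / β n (G x)) • n) = G := by
        ext; simp
      rw [h0, mul_eq_right₀ hG] at h1
      simpa [hx'] using h1
    · suffices key : ∀ t : Module.Dual F X ⊗[F] N, ∀ G : X →ₗ[F] U,
          Φ (G - N.subtype ∘ₗ dualTensorHomEquiv F X N t) = Φ G by
        have := key ((dualTensorHomEquiv F X N).symm ((G - G').codRestrict N hGG)) G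
        rw [← this]
        congr 1
        ext x
        simp
      intro t
      induction t using TensorProduct.induction_on with
      | zero => simp
      | add s t hs ht =>
        intro G
        rw [map_add, LinearMap.comp_add, ← sub_sub, ht, hs]
      | tmul y n =>
        intro G
        have h1 := congrFun (h n n.2 (0, y)) G
        rw [weyl_tensor_apply] at h1
        simp only [map_zero, zero_mul, mul_zero, sub_zero, AddChar.map_zero_eq_one, one_mul] at h1
        rw [← h1]
        congr 1

end CodeWeyl

section TensorImplements

variable {F : Type*} [Field F] {X U : Type*} [AddCommGroup X] [Module F X] [Module.Finite F X]
  [AddCommGroup U] [Module F U] {β : LinearMap.BilinForm F U} {ψ : AddChar F ℂ}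

/-- To implement a symplectic map it suffices to do so on pure tensors. -/
lemma implements_of_tmul (h2 : (2 : F) ≠ 0) (R : Sp (tensorPairing X β))
    (T : Module.End ℂ ((X →ₗ[F] U) → ℂ))
    (h : ∀ u v, T * weyl ψ (tensorPairing X β) (tensorEquiv F X U (u ⊗ₜ v)) =
      weyl ψ (tensorPairing X β)
        ((R : _ ≃ₗ[F] (U ⊗[F] X) × (X →ₗ[F] U)) (tensorEquiv F X U (u ⊗ₜ v))) * T) :
    Implements ψ (tensorPairing X β) R T := by
  intro w
  obtain ⟨t, rfl⟩ := (tensorEquiv F X U).surjective w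
  induction t using TensorProduct.induction_on with
  | zero => simp [weyl_zero]
  | tmul u v => exact h u v
  | add s t hs ht =>
    have e1 := weyl_mul ψ (tensorPairing X β) h2 (tensorEquiv F X U s) (tensorEquiv F X U t)
    have e2 := weyl_mul ψ (tensorPairing X β) h2
      ((R : _ ≃ₗ[F] (U ⊗[F] X) × (X →ₗ[F] U)) (tensorEquiv F X U s))
      ((R : _ ≃ₗ[F] (U ⊗[F] X) × (X →ₗ[F] U)) (tensorEquiv F X U t))
    rw [R.2, ← map_add, ← map_add] at e2
    rw [← map_add] at e1
    have h3 : T * (weyl ψ (tensorPairing X β) (tensorEquiv F X U s) *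
        weyl ψ (tensorPairing X β) (tensorEquiv F X U t)) =
        (weyl ψ (tensorPairing X β)
          ((R : _ ≃ₗ[F] (U ⊗[F] X) × (X →ₗ[F] U)) (tensorEquiv F X U s)) *
        weyl ψ (tensorPairing X β)
          ((R : _ ≃ₗ[F] (U ⊗[F] X) × (X →ₗ[F] U)) (tensorEquiv F X U t))) * T := by
      rw [← mul_assoc, hs, mul_assoc, ht, ← mul_assoc]
    rw [e1, e2, mul_smul_comm, smul_mul_assoc] at h3
    exact smul_right_injective _ (AddChar.val_isUnit ψ _).ne_zero h3

end TensorImplements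

/-! ### The operators of `O(U) × Sp(V)` -/

section TensorDet

variable {F : Type*} [Field F] {X U : Type*} [AddCommGroup X] [Module F X] [Module.Finite F X]
  [AddCommGroup U] [Module F U] [Module.Finite F U]

lemma det_rTensor (g : U →ₗ[F] U) :
    LinearMap.det (g.rTensor X) = LinearMap.det g ^ Module.finrank F X := by
  classical
  let u := Module.finBasis F U
  let x := Module.finBasis F X
  rw [← LinearMap.det_toMatrix (u.tensorProduct x), LinearMap.rTensor,
    TensorProduct.toMatrix_map, Matrix.det_kronecker, LinearMap.det_toMatrix]
  simp

end TensorDet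

section TensorRep

variable {p : ℕ} [Fact p.Prime] (hp : p ≠ 2) {F : Type*} [Field F] [Finite F]
  [Algebra (ZMod p) F] {X : Type*} [AddCommGroup X] [Module F X] [Module.Finite F X]
  {U : Type*} [AddCommGroup U] [Module F U] [Module.Finite F U]
  {β : LinearMap.BilinForm F U} (hs : β.IsSymm) (hn : β.Nondegenerate)

lemma tensorRep_implements (h : isometryGroup β × Sp (Module.Dual.eval F X)) :
    Implements (omega p F) (tensorPairing X β) (tensorAut h.1 h.2)
      (tensorRep X hp hs hn h) := by
  have := tensorPairing_isPerfPair (X := X) hn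
  exact (oscillatorRep_spec hp (tensorPairing X β)).map_weyl (tensorEmbedding hs h)

lemma tensorRep_weyl_tmul (h : isometryGroup β × Sp (Module.Dual.eval F X)) (u : U)
    (v : X × Module.Dual F X) (f : (X →ₗ[F] U) → ℂ) :
    tensorRep X hp hs hn h
        (weyl (omega p F) (tensorPairing X β) (tensorEquiv F X U (u ⊗ₜ v)) f) =
      weyl (omega p F) (tensorPairing X β)
        (tensorEquiv F X U ((h.1 : U ≃ₗ[F] U) u ⊗ₜ
          (h.2 : (X × Module.Dual F X) ≃ₗ[F] (X × Module.Dual F X)) v))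
        (tensorRep X hp hs hn h f) := by
  have := LinearMap.congr_fun (tensorRep_implements hp hs hn h (tensorEquiv F X U (u ⊗ₜ v))) f
  rwa [tensorAut_apply, TensorProduct.congr_tmul] at this

/-- A transvection along `z ∈ X` is of the form `(1, A; 0, 1)` on `U ⊗ V`. -/
lemma tensorRep_transvection (a : F) (z : X) (f : (X →ₗ[F] U) → ℂ) (G : X →ₗ[F] U) :
    tensorRep X hp hs hn (1, symplecticTransvection (symplecticForm_isAlt _) a (z, 0)) f G =
      omega p F (2⁻¹ * (-a * β (G z) (G z))) * f G := by
  have := tensorPairing_isPerfPair (X := X) hn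
  let A : (X →ₗ[F] U) →ₗ[F] (U ⊗[F] X) :=
    (-a) • ((TensorProduct.mk F U X).flip z ∘ₗ LinearMap.applyₗ z)
  have h := (oscillatorRep_spec hp (tensorPairing X β)).map_N
    (tensorEmbedding hs (1, symplecticTransvection (symplecticForm_isAlt _) a (z, 0))) A (by
      intro x y
      change tensorAut _ _ _ = (x + A (x, y).2, (x, y).2)
      conv_rhs => rw [show x = (x, y).1 from rfl]
      generalize (x, y) = w
      obtain ⟨t, rfl⟩ := (tensorEquiv F X U).surjective w
      rw [tensorAut_apply]
      induction t using TensorProduct.induction_on with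
      | zero => simp [Prod.ext_iff]
      | add s t hs ht =>
        rw [map_add, map_add, hs, ht, map_add, Prod.mk_add_mk, Prod.snd_add, Prod.fst_add,
          map_add, add_add_add_comm]
      | tmul u v =>
        obtain ⟨x, y⟩ := v
        rw [TensorProduct.congr_tmul, symplecticTransvection_apply]
        have e : symplecticForm (Module.Dual.eval F X) (x, y) (z, 0) = - y z := by
          simp [symplecticForm_apply]
        rw [e, Prod.smul_mk, Prod.mk_add_mk, smul_zero, add_zero, tensorEquiv_tmul,
          tensorEquiv_tmul]
        refine Prod.ext ?_ rfl
        simp [A, TensorProduct.tmul_add, TensorProduct.tmul_neg,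
          TensorProduct.smul_tmul', TensorProduct.tmul_smul, smul_smul]) f G
  refine h.trans ?_
  simp [A]

/-- An isometry of `U` is of the form `(C, 0; 0, C^{-t})` on `U ⊗ V`. -/
lemma tensorRep_isometry (g : isometryGroup β) (f : (X →ₗ[F] U) → ℂ) (G : X →ₗ[F] U) :
    tensorRep X hp hs hn (g, 1) f (((g : U ≃ₗ[F] U) : U →ₗ[F] U) ∘ₗ G) =
      legendre (LinearMap.det ((g : U ≃ₗ[F] U) : U →ₗ[F] U) ^ Module.finrank F X) * f G := by
  have := tensorPairing_isPerfPair (X := X) hn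
  have h := (oscillatorRep_spec hp (tensorPairing X β)).map_D (tensorEmbedding hs (g, 1))
    (TensorProduct.congr (g : U ≃ₗ[F] U) (LinearEquiv.refl F X))
    ((LinearEquiv.refl F X).arrowCongr (g : U ≃ₗ[F] U)) (by
      intro x y
      change tensorAut _ _ _ =
        (TensorProduct.congr (g : U ≃ₗ[F] U) (LinearEquiv.refl F X) (x, y).1,
          (LinearEquiv.refl F X).arrowCongr (g : U ≃ₗ[F] U) (x, y).2)
      generalize (x, y) = w
      obtain ⟨t, rfl⟩ := (tensorEquiv F X U).surjective w
      rw [tensorAut_apply]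
      induction t using TensorProduct.induction_on with
      | zero => simp [Prod.ext_iff]
      | add s t hs ht =>
        rw [map_add, map_add, hs, ht, map_add, Prod.mk_add_mk, Prod.snd_add, Prod.fst_add,
          map_add, map_add]
      | tmul u v =>
        obtain ⟨x, y⟩ := v
        rw [TensorProduct.congr_tmul, tensorEquiv_tmul]
        change tensorEquiv F X U ((g : U ≃ₗ[F] U) u ⊗ₜ (x, y)) = _
        rw [tensorEquiv_tmul]
        refine Prod.ext rfl ?_
        ext x
        rw [tensorEquiv_tmul]
        simp) f G
  rw [← det_rTensor]
  exact h

end TensorRep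

/-! ### The representation on the code -/

/-- Two representations whose operators are proportional differ by a linear character. -/
lemma exists_character_smul {G V : Type*} [Group G] [AddCommGroup V] [Module ℂ V] [Nontrivial V]
    (ρ σ : Representation ℂ G V) (h : ∀ g, ∃ c : ℂ, ρ g = c • σ g) :
    ∃ χ : G →* ℂ, (∀ g, ρ g = χ g • σ g) ∧ ∀ g, ρ g = σ g → χ g = 1 := by
  choose c hc using h
  have hinj : ∀ g, Function.Injective fun a : ℂ => a • σ g := fun g =>
    smul_left_injective ℂ ((Group.isUnit g).map σ).ne_zero
  refine ⟨⟨⟨c, hinj 1 ?_⟩, fun g g' => hinj (g * g') ?_⟩, hc, fun g hg => hinj g ?_⟩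
  · change c 1 • σ 1 = (1 : ℂ) • σ 1
    rw [← hc, one_smul, map_one, map_one]
  · change c (g * g') • σ (g * g') = (c g * c g') • σ (g * g')
    rw [← hc, map_mul, map_mul, hc, hc, smul_mul_smul_comm]
  · change c g • σ g = (1 : ℂ) • σ g
    rw [← hc, hg, one_smul]

section CodeRep

variable {p : ℕ} [Fact p.Prime] (hp : p ≠ 2) {F : Type*} [Field F] [Finite F]
  [Algebra (ZMod p) F] {X : Type*} [AddCommGroup X] [Module F X] [Module.Finite F X]
  {U : Type*} [AddCommGroup U] [Module F U] [Module.Finite F U]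
  {β : LinearMap.BilinForm F U} (hs : β.IsSymm) (hn : β.Nondegenerate)
  {N : Submodule F U}

lemma tensorRep_mem_cssCode (hN : N ≤ β.orthogonal N)
    (h : stabilizer β N × Sp (Module.Dual.eval F X))
    {Φ : (X →ₗ[F] U) → ℂ} (hΦ : Φ ∈ cssCode X β N) :
    tensorRep X hp hs hn (h.1, h.2) Φ ∈ cssCode X β N := by
  rw [mem_cssCode_iff hs (omega_ne_one p F) hN] at hΦ ⊢
  intro n hnN v
  have e := tensorRep_weyl_tmul hp hs hn (h.1, h.2)
    (((h.1⁻¹ : stabilizer β N) : isometryGroup β).1 n) (h.2⁻¹.1 v) Φ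
  rw [hΦ _ (stabilizer_apply_mem h.1⁻¹ hnN)] at e
  have e1 : ((h.1 : isometryGroup β) : U ≃ₗ[F] U)
      (((h.1⁻¹ : stabilizer β N) : isometryGroup β).1 n) = n :=
    LinearEquiv.apply_symm_apply _ n
  have e2 : (h.2 : (X × Module.Dual F X) ≃ₗ[F] (X × Module.Dual F X)) (h.2⁻¹.1 v) = v :=
    LinearEquiv.apply_symm_apply _ v
  simp only [e1, e2] at e
  exact e.symm

variable (hN : N ≤ β.orthogonal N)

variable (X) in
/-- The code as a subrepresentation of the restriction of `μ_{U ⊗ V}` to `O_N × Sp(V)`. -/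
noncomputable def codeSubrep : Subrepresentation ((tensorRep X hp hs hn).comp
    ((stabilizer β N).subtype.prodMap (MonoidHom.id (Sp (Module.Dual.eval F X))))) where
  toSubmodule := cssCode X β N
  apply_mem_toSubmodule h _ hΦ := tensorRep_mem_cssCode hp hs hn hN h hΦ

variable (X) in
/-- The representation on the code, transported to `L²(Hom(X → N^⊥ / N))`. -/
noncomputable def codeRep : Representation ℂ (stabilizer β N × Sp (Module.Dual.eval F X))
    ((X →ₗ[F] Reduced β N) → ℂ) :=
  ((codeEquiv X hN).symm.conjRingEquiv : Module.End ℂ (cssCode X β N) →* _).comp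
    (codeSubrep hp X hs hn hN).toRepresentation

lemma codeEmbedding_codeRep (h : stabilizer β N × Sp (Module.Dual.eval F X))
    (f : (X →ₗ[F] Reduced β N) → ℂ) :
    codeEmbedding X β N (codeRep hp X hs hn hN h f) =
      tensorRep X hp hs hn (h.1, h.2) (codeEmbedding X β N f) := by
  rw [← coe_codeEquiv hN, ← coe_codeEquiv hN]
  exact congrArg Subtype.val ((codeEquiv X hN).apply_symm_apply _)

lemma codeRep_implements (h : stabilizer β N × Sp (Module.Dual.eval F X)) :
    Implements (omega p F) (tensorPairing X (reducedForm hs N))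
      (tensorAut (toReduced hs N h.1) h.2) (codeRep hp X hs hn hN h) := by
  refine implements_of_tmul (two_ne_zero_of_odd hp F)
    ⟨_, tensorAut_mem (reducedForm_isSymm hs N) (toReduced hs N h.1) h.2⟩ _ fun u v => ?_
  obtain ⟨u, rfl⟩ := Submodule.Quotient.mk_surjective _ u
  refine LinearMap.ext fun f => codeEmbedding_injective ?_
  dsimp only
  rw [tensorAut_apply, TensorProduct.congr_tmul, toReduced_mk, Module.End.mul_apply,
    Module.End.mul_apply, codeEmbedding_codeRep, ← weyl_codeEmbedding _ hs, tensorRep_weyl_tmul,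
    ← weyl_codeEmbedding _ hs, codeEmbedding_codeRep]

/-- On transvections along vectors of `X`, both sides are multiplication operators. -/
lemma codeRep_transvection (hn' : (reducedForm hs N).Nondegenerate) (a : F) (z : X) :
    codeRep hp X hs hn hN (1, symplecticTransvection (symplecticForm_isAlt _) a (z, 0)) =
      tensorRep X hp (reducedForm_isSymm hs N) hn'
        (1, symplecticTransvection (symplecticForm_isAlt _) a (z, 0)) := by
  refine LinearMap.ext fun f => codeEmbedding_injective (funext fun G => ?_)
  rw [codeEmbedding_codeRep]
  refine (tensorRep_transvection hp hs hn a z (codeEmbedding X β N f) G).trans ?_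
  by_cases hG : ∀ x, G x ∈ β.orthogonal N
  · have e := tensorRep_transvection hp (reducedForm_isSymm hs N) hn' a z f (reduceHom G hG)
    rw [codeEmbedding_of_mem f hG]
    exact e.symm.trans (codeEmbedding_of_mem _ hG).symm
  · rw [codeEmbedding_of_not_mem f hG, mul_zero]
    exact (codeEmbedding_of_not_mem _ hG).symm

/-- On isometries, both sides are composition operators up to a sign, and the signs agree because
an isometry and its reduction have the same determinant. -/
lemma codeRep_isometry (hn' : (reducedForm hs N).Nondegenerate) (g : stabilizer β N) :
    codeRep hp X hs hn hN (g, 1) =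
      tensorRep X hp (reducedForm_isSymm hs N) hn' (toReduced hs N g, 1) := by
  refine LinearMap.ext fun f => funext fun H => ?_
  obtain ⟨H, rfl⟩ := ((LinearEquiv.refl F X).arrowCongr
    (toReduced hs N g : Reduced β N ≃ₗ[F] Reduced β N)).surjective H
  refine Eq.trans ?_
    (tensorRep_isometry hp (reducedForm_isSymm hs N) hn' (toReduced hs N g) f H).symm
  have hmem : ∀ x, ((((g : isometryGroup β) : U ≃ₗ[F] U) : U →ₗ[F] U) ∘ₗ liftHom H) x ∈
      β.orthogonal N := fun x => stabilizer_apply_mem_orthogonal g (liftHom_mem H x)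
  have e1 := tensorRep_isometry hp hs hn (g : isometryGroup β) (codeEmbedding X β N f)
    (liftHom H)
  have e2 := congrFun (codeEmbedding_codeRep hp hs hn hN (g, 1) f)
    ((((g : isometryGroup β) : U ≃ₗ[F] U) : U →ₗ[F] U) ∘ₗ liftHom H)
  rw [codeEmbedding_of_mem f (liftHom_mem H), reduceHom_liftHom, det_toReduced hs hn hN] at e1
  rw [codeEmbedding_of_mem _ hmem] at e2
  rw [← e1, ← e2]
  refine congrArg (codeRep hp X hs hn hN (g, 1) f) (LinearMap.ext fun x => ?_)
  conv_lhs => rw [← reduceHom_liftHom H]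
  rfl

/-- The two representations differ by a linear character of `O_N × Sp(V)`, which is trivial on both
factors. -/
theorem codeRep_eq (hn' : (reducedForm hs N).Nondegenerate)
    (h : stabilizer β N × Sp (Module.Dual.eval F X)) :
    codeRep hp X hs hn hN h =
      tensorRep X hp (reducedForm_isSymm hs N) hn' (toReduced hs N h.1, h.2) := by
  have hs' := reducedForm_isSymm hs N
  have := tensorPairing_isPerfPair (X := X) hn'
  have : Finite (Reduced β N ⊗[F] X) := Module.finite_of_finite F
  have : Finite (X →ₗ[F] Reduced β N) := Module.finite_of_finite F
  have := Fintype.ofFinite (Reduced β N ⊗[F] X)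
  have := Fintype.ofFinite (X →ₗ[F] Reduced β N)
  let σ : Representation ℂ (stabilizer β N × Sp (Module.Dual.eval F X))
      ((X →ₗ[F] Reduced β N) → ℂ) := (tensorRep X hp hs' hn').comp
    ((toReduced hs N).prodMap (MonoidHom.id (Sp (Module.Dual.eval F X))))
  have hσ : ∀ g S, σ (g, S) = tensorRep X hp hs' hn' (toReduced hs N g, S) := fun _ _ => rfl
  obtain ⟨χ, hχ, hχ1⟩ := exists_character_smul (codeRep hp X hs hn hN) σ fun h =>
    (tensorRep_implements hp hs' hn' (toReduced hs N h.1, h.2)).eq_smul (omega_ne_one p F)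
      (codeRep_implements hp hs hn hN h) ((Group.isUnit h).map σ)
  have hSp : ∀ S, χ (1, S) = 1 :=
    character_eq_one (χ.comp (MonoidHom.inr (stabilizer β N) _)) fun a z =>
      hχ1 (1, _) (by rw [hσ, map_one]; exact codeRep_transvection hp hs hn hN hn' a z)
  have hO : ∀ g, χ (g, 1) = 1 := fun g =>
    hχ1 _ (by rw [hσ]; exact codeRep_isometry hp hs hn hN hn' g)
  have hχh : χ h = χ ((h.1, 1) * (1, h.2)) := by simp
  rw [hχ, hχh, map_mul, hO, hSp, one_mul, one_smul]
  rfl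

end CodeRep

end CSSRep

theorem mainTheorem3 {p : ℕ} [Fact p.Prime] (hp : p ≠ 2)
    {F : Type*} [Field F] [Finite F] [Algebra (ZMod p) F]
    {X : Type*} [AddCommGroup X] [Module F X] [Module.Finite F X]
    {U : Type*} [AddCommGroup U] [Module F U] [Module.Finite F U]
    (β : LinearMap.BilinForm F U) (hs : β.IsSymm) (hn : β.Nondegenerate)
    (N : Submodule F U) (hN : N ≤ β.orthogonal N) :
    ∃ (hs' : (CSSRep.reducedForm hs N).IsSymm) (hn' : (CSSRep.reducedForm hs N).Nondegenerate),
      (Module.finrank F (CSSRep.Reduced β N) : ℤ) =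
        Module.finrank F U - 2 * Module.finrank F N ∧
      CSSRep.discriminant hn' =
        QuotientGroup.mk ((-1) ^ Module.finrank F N) * CSSRep.discriminant hn ∧
      Function.Surjective (CSSRep.toReduced hs N) ∧
      ∃ C : Subrepresentation ((CSSRep.tensorRep X hp hs hn).comp
          ((CSSRep.stabilizer β N).subtype.prodMap
            (MonoidHom.id (CSSRep.Sp (Module.Dual.eval F X))))),
        C.toSubmodule = CSSRep.cssCode X β N ∧
        Nonempty (C.toRepresentation.Equiv ((CSSRep.tensorRep X hp hs' hn').comp
          ((CSSRep.toReduced hs N).prodMap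
            (MonoidHom.id (CSSRep.Sp (Module.Dual.eval F X)))))) := by
  have hn' := CSSRep.reducedForm_nondegenerate hs hn N
  refine ⟨CSSRep.reducedForm_isSymm hs N, hn', CSSRep.finrank_reduced hn hN,
    CSSRep.discriminant_reduced hs hn hN hn', CSSRep.toReduced_surjective hs hn,
    CSSRep.codeSubrep hp X hs hn hN, rfl, ⟨.mk (CSSRep.codeEquiv X hN).symm fun h => ?_⟩⟩
  refine LinearMap.ext fun Φ => ?_
  obtain ⟨f, rfl⟩ := (CSSRep.codeEquiv X hN).surjective Φ
  refine (LinearMap.congr_fun (CSSRep.codeRep_eq hp hs hn hN hn' h) f).trans ?_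
  exact congrArg _ ((CSSRep.codeEquiv X hN).symm_apply_apply f).symm
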